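/- Let $n\ge 1$ and consider the Cauchy problem $$u_t(x,t)+|\nabla u(x,t)|\,f\big(u(x,t),\mu(\{u(\cdot,t)<u(x,t)\})\big)=0\ \text{ in }\mathbb R^n\times(0,\infty),\qquad u(\cdot,0)=u_0\ \text{ in }\mathbb R^n. \tag{P}$$ Assume: (A1) $f:\mathbb R\times[0,\infty)\to\mathbb R$ is bounded and continuous, and there is a modulus of continuity $\omega_f$ with $|f(r,q_1)-f(r,q_2)|\le\omega_f(|q_1-q_2|)$ for all $r\in\mathbb R$, $q_1,q_2\ge 0$; (A2) $f(r_1,q)\le f(r_2,q)$ for $r_1<r_2$, $q\ge 0$, and $f(r,q_1)<f(r,q_2)$ for $r\in\mathbb R$, $0\le q_1<q_2$; (A3) $\mu(A)=\int_A\Theta(x)\,dx$ with $\Theta\in L^1(\mathbb R^n)$, $\Theta>0$ in $\mathbb R^n$; (A4) $u_0:\mathbb R^n\to\mathbb R$ is uniformly continuous and $\lim_{R\to\infty}\inf\{u_0(y):|y|\ge R\}>u_0(x)$ for every $x\in\mathbb R^n$ (the limit is taken in $[-\infty,\infty]$). For $A\subset\mathbb R^n$ let $\mathrm{sd}(x,A)=\mathrm{dist}(x,A)-\mathrm{dist}(x,\mathbb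 R^n\setminus A)\in[-\infty,\infty]$, where $\mathrm{dist}(x,\emptyset)=+\infty$. For $h,s\in\mathbb R$ let $$D_h(s)=\{x:\mathrm{sd}(x,\{u_0<h\})<s\},\qquad E_h(s)=\{x:\mathrm{sd}(x,\{u_0\le h\})\le s\}.$$ Suppose that $\overline h\in\mathbb R$ satisfies $$f\big(\overline h,\mu(\{u_0<\overline h\})\big)\le 0\le f\big(\overline h,\mu(\{u_0\le\overline h\})\big).$$ For $W\in\{D,E\}$ and $h\in\mathbb R$ consider the Lipschitz functions $\delta:[0,\infty)\to\mathbb R$ with $\delta(0)=0$ and $$f\big(h,\mu(\mathrm{int}\,W_h(\delta(t)))\big)\le\delta'(t)\le f\big(h,\mu(\mathrm{cl}\,W_h(\delta(t)))\big)\quad\text{for a.e. }t\ge 0. \tag{I}$$ Then, for every $h$, (I) has a (pointwise) minimal solution for $W=D$, denoted $\delta_D(\cdot,h)$, and a maximal solution for $W=E$, denoted $\delta_E(\cdot,h)$; moreover, for all $t\ge0$, $\delta_D(t,h)\ge0$ if $h>\overline h$, $\delta_D(t,h)\le0$ if $h\le\overline h$, $\delta_E(t,h)\ge0$ if $h\ge\overline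 h$, and $\delta_E(t,h)\le0$ if $h<\overline h$. Hence the following functions are well defined, with $U_0(y,h)=u_0(y)-h$: $$U_D(x,t,h)=\begin{cases}\min\{U_0(y,h):|y-x|\le\delta_D(t,h)\}&\text{if }h>\overline h,\\ \max\{U_0(y,h):|y-x|\le-\delta_D(t,h)\}&\text{if }h\le\overline h,\end{cases}$$ $$U_E(x,t,h)=\begin{cases}\min\{U_0(y,h):|y-x|\le\delta_E(t,h)\}&\text{if }h\ge\overline h,\\ \max\{U_0(y,h):|y-x|\le-\delta_E(t,h)\}&\text{if }h<\overline h.\end{cases}$$ For all $(x,t)\in\mathbb R^n\times[0,\infty)$ the numbers $$u_D(x,t)=\sup\{h\in\mathbb R:U_D(x,t,h)\ge 0\},\qquad u_E(x,t)=\inf\{h\in\mathbb R:U_E(x,t,h)\le 0\}$$ are finite, $u_D=u_E$ on $\mathbb R^n\times[0,\infty)$, and $u:=u_D=u_E$ is the unique function $u\in C(\mathbb R^n\times[0,\infty))$ that is a viscosity solution of (P) with $u(\cdot,0)=u_0$ and satisfies the growth condition: for every $T>0$ there is $M_T>0$ with $|u(x,t)|\le M_T(|x|+1)$ for all $(x,t)\in\mathbb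 R^n\times[0,T]$. Here a viscosity solution is a continuous function that is both a subsolution and a supersolution. A locally bounded upper semicontinuous $u:\mathbb R^n\times(0,\infty)\to\mathbb R$ is a subsolution if, whenever $\varphi\in C^1(\mathbb R^n\times(0,\infty))$ and $u-\varphi$ has a local maximum at $(x_0,t_0)$, then $$\varphi_t(x_0,t_0)+|\nabla\varphi(x_0,t_0)|\,f\big(u(x_0,t_0),\mu(\{u(\cdot,t_0)<u(x_0,t_0)\})\big)\le 0;$$ a locally bounded lower semicontinuous $u$ is a supersolution if, whenever $\varphi\in C^1(\mathbb R^n\times(0,\infty))$ and $u-\varphi$ has a local minimum at $(x_0,t_0)$, then $$\varphi_t(x_0,t_0)+|\nabla\varphi(x_0,t_0)|\,f\big(u(x_0,t_0),\mu(\{u(\cdot,t_0)\le u(x_0,t_0)\})\big)\ge 0.$$ -/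

import Mathlib

open scoped NNReal ENNReal Topology
open Set Filter MeasureTheory

noncomputable section

namespace NonlocalHJ

/-- Modulus of continuity on `[0, ∞)`. -/
structure IsModulus (ω : ℝ → ℝ) : Prop where
  mono : MonotoneOn ω (Ici 0)
  zero : ω 0 = 0
  tendsto_zero : Tendsto ω (𝓝[≥] 0) (𝓝 0)

/-- (A1): `f : ℝ × [0, ∞) → ℝ` is bounded and continuous, with a modulus of continuity in the
second variable that is uniform in the first one. -/
structure AssumptionA1 (f : ℝ → ℝ≥0 → ℝ) : Prop where
  bounded : ∃ M : ℝ, ∀ r q, |f r q| ≤ M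
  cont : Continuous fun p : ℝ × ℝ≥0 => f p.1 p.2
  modulus : ∃ ω : ℝ → ℝ, IsModulus ω ∧
    ∀ (r : ℝ) (q₁ q₂ : ℝ≥0), |f r q₁ - f r q₂| ≤ ω |(q₁ : ℝ) - (q₂ : ℝ)|

/-- (A2): `f` is nondecreasing in the first and strictly increasing in the second variable. -/
structure AssumptionA2 (f : ℝ → ℝ≥0 → ℝ) : Prop where
  mono_left : ∀ (r₁ r₂ : ℝ) (q : ℝ≥0), r₁ < r₂ → f r₁ q ≤ f r₂ q
  strictMono_right : ∀ (r : ℝ) (q₁ q₂ : ℝ≥0), q₁ < q₂ → f r q₁ < f r q₂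

variable {n : ℕ}

/-- (A3): the density `Θ` is integrable and positive. -/
structure AssumptionA3 (Θ : EuclideanSpace ℝ (Fin n) → ℝ) : Prop where
  integrable : Integrable Θ volume
  pos : ∀ x, 0 < Θ x

/-- The measure `A ↦ ∫_A Θ(x) dx`. -/
def weightedMeasure (Θ : EuclideanSpace ℝ (Fin n) → ℝ) : Measure (EuclideanSpace ℝ (Fin n)) :=
  volume.withDensity fun x => ENNReal.ofReal (Θ x)

/-- The number `μ(A) ∈ [0, ∞)`; the measure is finite under (A3). -/
def mu (Θ : EuclideanSpace ℝ (Fin n) → ℝ) (A : Set (EuclideanSpace ℝ (Fin n))) : ℝ≥0 :=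
  (weightedMeasure Θ A).toNNReal

/-- (A4): `u₀` is uniformly continuous and `lim_{R → ∞} inf {u₀ y : |y| ≥ R} > u₀ x` for all `x`.
The infimum and the limit are taken in `[-∞, ∞]`. -/
structure AssumptionA4 (u₀ : EuclideanSpace ℝ (Fin n) → ℝ) : Prop where
  unifCont : UniformContinuous u₀
  coercive : ∃ L : EReal,
    Tendsto (fun R : ℝ => ⨅ y : {y : EuclideanSpace ℝ (Fin n) // R ≤ ‖y‖}, (u₀ y : EReal))
      atTop (𝓝 L) ∧
    ∀ x, (u₀ x : EReal) < L

/-- The signed distance `sd(x, A) = dist(x, A) - dist(x, Aᶜ)` with values in `[-∞, ∞]`, where the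
distance to the empty set is `+∞`. One of the two distances is always zero. -/
def sd (x : EuclideanSpace ℝ (Fin n)) (A : Set (EuclideanSpace ℝ (Fin n))) : EReal :=
  (Metric.infEDist x A : EReal) - (Metric.infEDist x Aᶜ : EReal)

/-- The strict parallel sets `D_h(s) = {x : sd(x, {u₀ < h}) < s}`. -/
def parD (u₀ : EuclideanSpace ℝ (Fin n) → ℝ) (h s : ℝ) : Set (EuclideanSpace ℝ (Fin n)) :=
  {x | sd x {y | u₀ y < h} < (s : EReal)}

/-- The parallel sets `E_h(s) = {x : sd(x, {u₀ ≤ h}) ≤ s}`. -/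
def parE (u₀ : EuclideanSpace ℝ (Fin n) → ℝ) (h s : ℝ) : Set (EuclideanSpace ℝ (Fin n)) :=
  {x | sd x {y | u₀ y ≤ h} ≤ (s : EReal)}

/-- `h̄` is a threshold level:
`f(h̄, μ({u₀ < h̄})) ≤ 0 ≤ f(h̄, μ({u₀ ≤ h̄}))`. -/
def IsThreshold (f : ℝ → ℝ≥0 → ℝ) (Θ u₀ : EuclideanSpace ℝ (Fin n) → ℝ) (hbar : ℝ) : Prop :=
  f hbar (mu Θ {x | u₀ x < hbar}) ≤ 0 ∧ 0 ≤ f hbar (mu Θ {x | u₀ x ≤ hbar})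

/-- `δ` is a (Lipschitz) solution on `[0, ∞)` of the distance inclusion at level `h` for the family
of sets `W`: `δ(0) = 0` and, for a.e. `t ≥ 0`,
`f(h, μ(int W(δ(t)))) ≤ δ'(t) ≤ f(h, μ(cl W(δ(t))))`. -/
structure IsDistSol (f : ℝ → ℝ≥0 → ℝ) (Θ : EuclideanSpace ℝ (Fin n) → ℝ)
    (W : ℝ → Set (EuclideanSpace ℝ (Fin n))) (h : ℝ) (δ : ℝ → ℝ) : Prop where
  lipschitz : ∃ K : ℝ≥0, LipschitzOnWith K δ (Ici 0)
  init : δ 0 = 0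
  ineq : ∀ᵐ t ∂(volume.restrict (Ici (0 : ℝ))), ∃ d : ℝ, HasDerivAt δ d t ∧
    f h (mu Θ (interior (W (δ t)))) ≤ d ∧ d ≤ f h (mu Θ (closure (W (δ t))))

/-- `δ` is the minimal solution of the distance inclusion. -/
def IsMinDistSol (f : ℝ → ℝ≥0 → ℝ) (Θ : EuclideanSpace ℝ (Fin n) → ℝ)
    (W : ℝ → Set (EuclideanSpace ℝ (Fin n))) (h : ℝ) (δ : ℝ → ℝ) : Prop :=
  IsDistSol f Θ W h δ ∧ ∀ η, IsDistSol f Θ W h η → ∀ t, 0 ≤ t → δ t ≤ η t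

/-- `δ` is the maximal solution of the distance inclusion. -/
def IsMaxDistSol (f : ℝ → ℝ≥0 → ℝ) (Θ : EuclideanSpace ℝ (Fin n) → ℝ)
    (W : ℝ → Set (EuclideanSpace ℝ (Fin n))) (h : ℝ) (δ : ℝ → ℝ) : Prop :=
  IsDistSol f Θ W h δ ∧ ∀ η, IsDistSol f Θ W h η → ∀ t, 0 ≤ t → η t ≤ δ t

/-- `δ_D(t, h)`: the pointwise infimum of all solutions of the distance inclusion for `D_h`. -/
def deltaD (f : ℝ → ℝ≥0 → ℝ) (Θ u₀ : EuclideanSpace ℝ (Fin n) → ℝ) (t h : ℝ) : ℝ :=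
  sInf {r | ∃ δ, IsDistSol f Θ (parD u₀ h) h δ ∧ r = δ t}

/-- `δ_E(t, h)`: the pointwise supremum of all solutions of the distance inclusion for `E_h`. -/
def deltaE (f : ℝ → ℝ≥0 → ℝ) (Θ u₀ : EuclideanSpace ℝ (Fin n) → ℝ) (t h : ℝ) : ℝ :=
  sSup {r | ∃ δ, IsDistSol f Θ (parE u₀ h) h δ ∧ r = δ t}

/-- `U₀(x, h) = u₀(x) - h`. -/
def U0 (u₀ : EuclideanSpace ℝ (Fin n) → ℝ) (x : EuclideanSpace ℝ (Fin n)) (h : ℝ) : ℝ :=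
  u₀ x - h

/-- The values `{U₀(y, h) : |y - x| ≤ ρ}`. -/
def ballValues (u₀ : EuclideanSpace ℝ (Fin n) → ℝ) (x : EuclideanSpace ℝ (Fin n)) (h ρ : ℝ) :
    Set ℝ :=
  {r | ∃ y, ‖y - x‖ ≤ ρ ∧ r = U0 u₀ y h}

open Classical in
/-- The value function `U_D(x, t, h)`. -/
def UD (f : ℝ → ℝ≥0 → ℝ) (Θ u₀ : EuclideanSpace ℝ (Fin n) → ℝ) (hbar : ℝ)
    (x : EuclideanSpace ℝ (Fin n)) (t h : ℝ) : ℝ :=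
  if hbar < h then sInf (ballValues u₀ x h (deltaD f Θ u₀ t h))
  else sSup (ballValues u₀ x h (-deltaD f Θ u₀ t h))

open Classical in
/-- The value function `U_E(x, t, h)`. -/
def UE (f : ℝ → ℝ≥0 → ℝ) (Θ u₀ : EuclideanSpace ℝ (Fin n) → ℝ) (hbar : ℝ)
    (x : EuclideanSpace ℝ (Fin n)) (t h : ℝ) : ℝ :=
  if hbar ≤ h then sInf (ballValues u₀ x h (deltaE f Θ u₀ t h))
  else sSup (ballValues u₀ x h (-deltaE f Θ u₀ t h))

/-- `u_D(x, t) = sup {h : U_D(x, t, h) ≥ 0}`. -/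
def uD (f : ℝ → ℝ≥0 → ℝ) (Θ u₀ : EuclideanSpace ℝ (Fin n) → ℝ) (hbar : ℝ)
    (x : EuclideanSpace ℝ (Fin n)) (t : ℝ) : ℝ :=
  sSup {h : ℝ | 0 ≤ UD f Θ u₀ hbar x t h}

/-- `u_E(x, t) = inf {h : U_E(x, t, h) ≤ 0}`. -/
def uE (f : ℝ → ℝ≥0 → ℝ) (Θ u₀ : EuclideanSpace ℝ (Fin n) → ℝ) (hbar : ℝ)
    (x : EuclideanSpace ℝ (Fin n)) (t : ℝ) : ℝ :=
  sInf {h : ℝ | UE f Θ u₀ hbar x t h ≤ 0}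

/-- `u` is locally bounded on `ℝⁿ × (0, ∞)`. -/
def IsLocBounded (u : EuclideanSpace ℝ (Fin n) → ℝ → ℝ) : Prop :=
  ∀ (x : EuclideanSpace ℝ (Fin n)) (t : ℝ), 0 < t →
    ∃ C : ℝ, ∀ᶠ z : EuclideanSpace ℝ (Fin n) × ℝ in 𝓝 (x, t), |u z.1 z.2| ≤ C

/-- Viscosity subsolutions on `ℝⁿ × (0, ∞)` of
`u_t + |∇u| f(u, μ({u(·, t) < u(x, t)})) = 0`. -/
structure IsViscSubsol (f : ℝ → ℝ≥0 → ℝ) (Θ : EuclideanSpace ℝ (Fin n) → ℝ)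
    (u : EuclideanSpace ℝ (Fin n) → ℝ → ℝ) : Prop where
  locBounded : IsLocBounded u
  usc : UpperSemicontinuousOn (fun z : EuclideanSpace ℝ (Fin n) × ℝ => u z.1 z.2)
    (univ ×ˢ Ioi 0)
  test : ∀ (φ : EuclideanSpace ℝ (Fin n) → ℝ → ℝ) (x₀ : EuclideanSpace ℝ (Fin n)) (t₀ : ℝ),
    ContDiffOn ℝ 1 (fun z : EuclideanSpace ℝ (Fin n) × ℝ => φ z.1 z.2) (univ ×ˢ Ioi 0) →
    0 < t₀ →
    IsLocalMax (fun z : EuclideanSpace ℝ (Fin n) × ℝ => u z.1 z.2 - φ z.1 z.2) (x₀, t₀) →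
    deriv (fun t => φ x₀ t) t₀ + ‖gradient (fun x => φ x t₀) x₀‖ *
      f (u x₀ t₀) (mu Θ {y | u y t₀ < u x₀ t₀}) ≤ 0

/-- Viscosity supersolutions of the same equation; here the closed sublevel set enters. -/
structure IsViscSupersol (f : ℝ → ℝ≥0 → ℝ) (Θ : EuclideanSpace ℝ (Fin n) → ℝ)
    (u : EuclideanSpace ℝ (Fin n) → ℝ → ℝ) : Prop where
  locBounded : IsLocBounded u
  lsc : LowerSemicontinuousOn (fun z : EuclideanSpace ℝ (Fin n) × ℝ => u z.1 z.2)
    (univ ×ˢ Ioi 0)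
  test : ∀ (φ : EuclideanSpace ℝ (Fin n) → ℝ → ℝ) (x₀ : EuclideanSpace ℝ (Fin n)) (t₀ : ℝ),
    ContDiffOn ℝ 1 (fun z : EuclideanSpace ℝ (Fin n) × ℝ => φ z.1 z.2) (univ ×ˢ Ioi 0) →
    0 < t₀ →
    IsLocalMin (fun z : EuclideanSpace ℝ (Fin n) × ℝ => u z.1 z.2 - φ z.1 z.2) (x₀, t₀) →
    0 ≤ deriv (fun t => φ x₀ t) t₀ + ‖gradient (fun x => φ x t₀) x₀‖ *
      f (u x₀ t₀) (mu Θ {y | u y t₀ ≤ u x₀ t₀})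

/-- `u` is a continuous viscosity solution of the Cauchy problem: it is continuous on
`ℝⁿ × [0, ∞)`, a viscosity sub- and supersolution for `t > 0`, and `u(·, 0) = u₀`.
Only the values of `u` at times `t ≥ 0` matter. -/
structure IsCauchySol (f : ℝ → ℝ≥0 → ℝ) (Θ u₀ : EuclideanSpace ℝ (Fin n) → ℝ)
    (u : EuclideanSpace ℝ (Fin n) → ℝ → ℝ) : Prop where
  cont : ContinuousOn (fun z : EuclideanSpace ℝ (Fin n) × ℝ => u z.1 z.2) (univ ×ˢ Ici 0)
  sub : IsViscSubsol f Θ u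
  super : IsViscSupersol f Θ u
  init : ∀ x, u x 0 = u₀ x

/-- Linear growth in space, locally uniformly in time. -/
def HasLinearGrowth (u : EuclideanSpace ℝ (Fin n) → ℝ → ℝ) : Prop :=
  ∀ T : ℝ, 0 < T → ∃ M : ℝ, 0 < M ∧
    ∀ (x : EuclideanSpace ℝ (Fin n)) (t : ℝ), 0 ≤ t → t ≤ T → |u x t| ≤ M * (‖x‖ + 1)

end NonlocalHJ

end

/-!
# Level-set solutions of a nonlocal Hamilton-Jacobi equation

For a fixed level `h` the speed `f(h, μ({u(·, t) < h}))` depends on time only, so the sublevel set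
at level `h` should stay a parallel set of its initial position, at a signed distance `δ(t)` that
solves the scalar distance inclusion. Monotonicity of `f` is what makes everything work:

* The right-hand side `g(s) = f(h, μ(D_h(s)))` is nondecreasing and left-continuous. Picard
  iteration from the subsolution `-Mt` is therefore increasing, and its limit is a solution lying
  below every supersolution (`IsMonoSpeed.exists_isMinFlow`). A minimal flow either grows forever or
  shrinks forever (`IsMinFlow.dichotomy`).
* If one front is strictly ahead of another, then its set is larger, hence so is its speed, and the
  gap never closes. This orders the fronts in `h`, keeps the distance between two levels that the
  uniform continuity of `u₀` provides at time `0` (`exists_parD_gap`), gives continuity of `u_D`,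
  and yields `u_D = u_E` (`levelSup_eq_neg_levelSup_dual`).
* `u_D` is a subsolution: a point outside the front at time `t₀` comes, backward in time, from a
  point outside the front at the right distance (`IsFlowFamily.isTestSub_levelSup`).
* `u_D` lies above every continuous subsolution `v` (`IsTestSub.le_levelSup`). Above a level
  `m > h`, `v` is a subsolution of an eikonal equation whose speed is at least that of the front at
  level `h`, as long as `{v ≤ m}` contains that front with a margin; propagation along
  characteristics (`le_of_propagation`) then preserves the margin. Test functions have to be `C¹`,
  so the front is driven by the average of `g` over an interval shorter than the margin.

The statements about `u_E` and about supersolutions are the same statements for `-u₀`, `-v` and the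
dual speed `-f(-h, μ(Sᶜ))` (`dualLaw`), because complements of closed parallel sets of `u₀` are open
parallel sets of `-u₀` (`compl_parE`). Together, a continuous solution `v` satisfies
`u_E ≤ v ≤ u_D`, hence uniqueness.
-/

namespace NonlocalHJ

/-! ### Scalar monotone flows -/

/-- Speeds admitting a monotone Picard iteration: nondecreasing, left-continuous and bounded. -/
structure IsMonoSpeed (M : ℝ) (g : ℝ → ℝ) : Prop where
  mono : Monotone g
  left_cont : ∀ s, ContinuousWithinAt g (Iic s) s
  bound : ∀ s, |g s| ≤ M

/-- `δ` is the minimal solution of `δ' = g(δ)`, `δ(0) = 0` on `[0, ∞)`, in integrated form; it is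
minimal even among supersolutions. -/
structure IsMinFlow (g δ : ℝ → ℝ) : Prop where
  cont : ContinuousOn δ (Ici 0)
  eq_integral : ∀ t, 0 ≤ t → δ t = ∫ s in (0 : ℝ)..t, g (δ s)
  le_of_super : ∀ η : ℝ → ℝ, ContinuousOn η (Ici 0) →
    (∀ t, 0 ≤ t → ∫ s in (0 : ℝ)..t, g (η s) ≤ η t) → ∀ t, 0 ≤ t → δ t ≤ η t

variable {M : ℝ} {g δ η : ℝ → ℝ}

theorem IsMonoSpeed.norm_le (hg : IsMonoSpeed M g) (s : ℝ) : ‖g s‖ ≤ ‖M‖ :=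
  (hg.bound s).trans (le_abs_self M)

theorem IsMonoSpeed.intervalIntegrable (hg : IsMonoSpeed M g) (hη : ContinuousOn η (Ici 0))
    {a b : ℝ} (ha : 0 ≤ a) (hb : 0 ≤ b) :
    IntervalIntegrable (fun s => g (η s)) volume a b := by
  have hc : Continuous fun s => η (max s 0) := by
    rw [← continuousOn_univ]
    exact hη.comp (by fun_prop) fun s _ => mem_Ici.2 (le_max_right s 0)
  have hm : Measurable fun s => g (η (max s 0)) := hg.mono.measurable.comp hc.measurable
  have hi : IntervalIntegrable (fun s => g (η (max s 0))) volume a b :=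
    (intervalIntegrable_const (c := M)).mono_fun hm.aestronglyMeasurable
      (Eventually.of_forall fun s => hg.norm_le _)
  refine hi.congr fun s hs => ?_
  have : 0 ≤ s := (le_min ha hb).trans hs.1.le
  simp [max_eq_left this]

theorem IsMonoSpeed.bound_nonneg (hg : IsMonoSpeed M g) : 0 ≤ M :=
  (abs_nonneg _).trans (hg.bound 0)

theorem IsMonoSpeed.abs_integral_le (hg : IsMonoSpeed M g) (η : ℝ → ℝ) (a b : ℝ) :
    |∫ s in a..b, g (η s)| ≤ M * |b - a| := by
  have := intervalIntegral.norm_integral_le_of_norm_le_const (a := a) (b := b) (C := M)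
    (f := fun s => g (η s)) (fun s _ => by rw [Real.norm_eq_abs]; exact hg.bound _)
  simpa using this

theorem IsMonoSpeed.integral_mono {θ : ℝ → ℝ} (hg : IsMonoSpeed M g)
    (hη : ContinuousOn η (Ici 0)) (hθ : ContinuousOn θ (Ici 0)) {t : ℝ} (ht : 0 ≤ t)
    (h : ∀ s, 0 ≤ s → η s ≤ θ s) :
    ∫ s in (0 : ℝ)..t, g (η s) ≤ ∫ s in (0 : ℝ)..t, g (θ s) :=
  intervalIntegral.integral_mono_on ht (hg.intervalIntegrable hη le_rfl ht)
    (hg.intervalIntegrable hθ le_rfl ht) fun s hs => hg.mono (h s hs.1)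

/-- Picard iterates of `δ' = g(δ)`, `δ(0) = 0`, starting from the subsolution `-Mt`. -/
noncomputable def picardIter (M : ℝ) (g : ℝ → ℝ) : ℕ → ℝ → ℝ
  | 0 => fun t => -(M * t)
  | k + 1 => fun t => ∫ s in (0 : ℝ)..t, g (picardIter M g k s)

theorem IsMonoSpeed.continuousOn_primitive (hg : IsMonoSpeed M g) (η : ℝ → ℝ)
    (hη : ContinuousOn η (Ici 0)) :
    ContinuousOn (fun t => ∫ s in (0 : ℝ)..t, g (η s)) (Ici 0) := by
  have hL : LipschitzOnWith (Real.toNNReal M) (fun t => ∫ s in (0 : ℝ)..t, g (η s)) (Ici 0) := by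
    refine LipschitzOnWith.of_dist_le_mul fun s hs t ht => ?_
    rw [Real.dist_eq, Real.dist_eq, Real.coe_toNNReal _ hg.bound_nonneg,
      intervalIntegral.integral_interval_sub_left (hg.intervalIntegrable hη le_rfl hs)
        (hg.intervalIntegrable hη le_rfl ht)]
    exact hg.abs_integral_le η t s
  exact hL.continuousOn

theorem IsMonoSpeed.continuousOn_picardIter (hg : IsMonoSpeed M g) (k : ℕ) :
    ContinuousOn (picardIter M g k) (Ici 0) := by
  induction k with
  | zero => exact (by fun_prop : Continuous fun t : ℝ => -(M * t)).continuousOn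
  | succ k ih => exact hg.continuousOn_primitive _ ih

theorem IsMonoSpeed.abs_picardIter_sub_le (hg : IsMonoSpeed M g) (k : ℕ) {s t : ℝ} (hs : 0 ≤ s)
    (ht : 0 ≤ t) : |picardIter M g k t - picardIter M g k s| ≤ M * |t - s| := by
  cases k with
  | zero =>
    simp only [picardIter]
    rw [show -(M * t) - -(M * s) = -(M * (t - s)) by ring, abs_neg, abs_mul,
      abs_of_nonneg hg.bound_nonneg]
  | succ k =>
    simp only [picardIter]
    rw [intervalIntegral.integral_interval_sub_left
      (hg.intervalIntegrable (hg.continuousOn_picardIter k) le_rfl ht)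
      (hg.intervalIntegrable (hg.continuousOn_picardIter k) le_rfl hs)]
    exact hg.abs_integral_le _ s t

theorem IsMonoSpeed.picardIter_zero_le (hg : IsMonoSpeed M g) (η : ℝ → ℝ) {t : ℝ} (ht : 0 ≤ t) :
    picardIter M g 0 t ≤ ∫ s in (0 : ℝ)..t, g (η s) := by
  have := hg.abs_integral_le η 0 t
  rw [sub_zero, abs_of_nonneg ht] at this
  exact (abs_le.1 this).1

theorem IsMonoSpeed.picardIter_le_succ (hg : IsMonoSpeed M g) (k : ℕ) :
    ∀ t, 0 ≤ t → picardIter M g k t ≤ picardIter M g (k + 1) t := by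
  induction k with
  | zero => exact fun t ht => hg.picardIter_zero_le _ ht
  | succ k ih =>
    exact fun t ht => hg.integral_mono (hg.continuousOn_picardIter k)
      (hg.continuousOn_picardIter (k + 1)) ht ih

theorem IsMonoSpeed.picardIter_le_super (hg : IsMonoSpeed M g) (hη : ContinuousOn η (Ici 0))
    (hsup : ∀ t, 0 ≤ t → ∫ s in (0 : ℝ)..t, g (η s) ≤ η t) (k : ℕ) :
    ∀ t, 0 ≤ t → picardIter M g k t ≤ η t := by
  induction k with
  | zero => exact fun t ht => (hg.picardIter_zero_le η ht).trans (hsup t ht)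
  | succ k ih =>
    exact fun t ht => (hg.integral_mono (hg.continuousOn_picardIter k) hη ht ih).trans (hsup t ht)

/-- The Picard iterates started at `-Mt` increase, and left-continuity of `g` lets the limit pass
through `g`; their limit is the minimal flow. -/
theorem IsMonoSpeed.exists_isMinFlow (hg : IsMonoSpeed M g) : ∃ δ, IsMinFlow g δ := by
  have hM := hg.bound_nonneg
  have hmono : ∀ t, 0 ≤ t → Monotone fun k => picardIter M g k t := fun t ht =>
    monotone_nat_of_le_succ fun k => hg.picardIter_le_succ k t ht
  have hbdd : ∀ t, 0 ≤ t → BddAbove (range fun k => picardIter M g k t) := by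
    rintro t ht
    refine ⟨M * t, ?_⟩
    rintro _ ⟨k, rfl⟩
    refine ((hmono t ht) k.le_succ).trans ?_
    have := hg.abs_integral_le (picardIter M g k) 0 t
    rw [sub_zero, abs_of_nonneg ht] at this
    exact (abs_le.1 this).2
  set δ : ℝ → ℝ := fun t => ⨆ k, picardIter M g k t with hδ
  have hlim : ∀ t, 0 ≤ t → Tendsto (fun k => picardIter M g k t) atTop (𝓝 (δ t)) := fun t ht =>
    tendsto_atTop_ciSup (hmono t ht) (hbdd t ht)
  have hle : ∀ t, 0 ≤ t → ∀ k, picardIter M g k t ≤ δ t := fun t ht k => le_ciSup (hbdd t ht) k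
  refine ⟨δ, ?_, ?_, ?_⟩
  · have hL : LipschitzOnWith (Real.toNNReal M) δ (Ici 0) := by
      refine LipschitzOnWith.of_dist_le_mul fun s hs t ht => ?_
      rw [Real.dist_eq, Real.dist_eq, Real.coe_toNNReal _ hM]
      exact le_of_tendsto ((hlim s hs).sub (hlim t ht)).abs
        (Eventually.of_forall fun k => hg.abs_picardIter_sub_le k ht hs)
    exact hL.continuousOn
  · intro t ht
    have h1 : Tendsto (fun k => picardIter M g (k + 1) t) atTop (𝓝 (δ t)) :=
      (hlim t ht).comp (tendsto_add_atTop_nat 1)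
    refine tendsto_nhds_unique h1 ?_
    refine intervalIntegral.tendsto_integral_filter_of_dominated_convergence (fun _ => M)
      (Eventually.of_forall fun k => ?_) (Eventually.of_forall fun k => ?_)
      intervalIntegrable_const ?_
    · exact (hg.intervalIntegrable (hg.continuousOn_picardIter k) le_rfl
        ht).aestronglyMeasurable_restrict_uIoc
    · exact Eventually.of_forall fun s _ => by rw [Real.norm_eq_abs]; exact hg.bound _
    · refine Eventually.of_forall fun s hs => ?_
      have hs0 : 0 ≤ s := by rw [uIoc_of_le ht] at hs; exact hs.1.le
      exact (hg.left_cont (δ s)).tendsto.comp (tendsto_nhdsWithin_iff.2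
        ⟨hlim s hs0, Eventually.of_forall fun k => hle s hs0 k⟩)
  · intro η hη hsup t ht
    exact le_of_tendsto (hlim t ht)
      (Eventually.of_forall fun k => hg.picardIter_le_super hη hsup k t ht)

namespace IsMinFlow

theorem zero (hδ : IsMinFlow g δ) : δ 0 = 0 := by
  simpa using hδ.eq_integral 0 le_rfl

theorem sub_eq_integral (hδ : IsMinFlow g δ) (hg : IsMonoSpeed M g) {s t : ℝ} (hs : 0 ≤ s)
    (ht : 0 ≤ t) : δ t - δ s = ∫ r in s..t, g (δ r) := by
  rw [hδ.eq_integral t ht, hδ.eq_integral s hs]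
  exact intervalIntegral.integral_interval_sub_left (hg.intervalIntegrable hδ.cont le_rfl ht)
    (hg.intervalIntegrable hδ.cont le_rfl hs)

theorem abs_sub_le (hδ : IsMinFlow g δ) (hg : IsMonoSpeed M g) {s t : ℝ} (hs : 0 ≤ s)
    (ht : 0 ≤ t) : |δ t - δ s| ≤ M * |t - s| := by
  rw [hδ.sub_eq_integral hg hs ht]
  exact hg.abs_integral_le _ _ _

theorem abs_le (hδ : IsMinFlow g δ) (hg : IsMonoSpeed M g) {t : ℝ} (ht : 0 ≤ t) :
    |δ t| ≤ M * t := by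
  simpa [hδ.zero, abs_of_nonneg ht] using hδ.abs_sub_le hg le_rfl ht

/-- A lower bound for the speed along the flow bounds its increments. -/
theorem mul_le_sub (hδ : IsMinFlow g δ) (hg : IsMonoSpeed M g) {s t c : ℝ} (hs : 0 ≤ s)
    (hst : s ≤ t) (hc : ∀ r, s ≤ r → r ≤ t → c ≤ g (δ r)) : c * (t - s) ≤ δ t - δ s := by
  rw [hδ.sub_eq_integral hg hs (hs.trans hst)]
  have := intervalIntegral.integral_mono_on hst (intervalIntegrable_const (c := c))
    (hg.intervalIntegrable hδ.cont hs (hs.trans hst)) fun r hr => hc r hr.1 hr.2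
  simp only [intervalIntegral.integral_const, smul_eq_mul] at this
  linarith

theorem sub_le_mul (hδ : IsMinFlow g δ) (hg : IsMonoSpeed M g) {s t c : ℝ} (hs : 0 ≤ s)
    (hst : s ≤ t) (hc : ∀ r, s ≤ r → r ≤ t → g (δ r) ≤ c) : δ t - δ s ≤ c * (t - s) := by
  rw [hδ.sub_eq_integral hg hs (hs.trans hst)]
  have := intervalIntegral.integral_mono_on hst
    (hg.intervalIntegrable hδ.cont hs (hs.trans hst)) (intervalIntegrable_const (c := c))
    fun r hr => hc r hr.1 hr.2
  simp only [intervalIntegral.integral_const, smul_eq_mul] at this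
  linarith

theorem nonpos (hδ : IsMinFlow g δ) (h0 : g 0 ≤ 0) {t : ℝ} (ht : 0 ≤ t) : δ t ≤ 0 := by
  refine hδ.le_of_super (fun _ => 0) continuousOn_const (fun t ht => ?_) t ht
  simp only [intervalIntegral.integral_const, sub_zero, smul_eq_mul]
  exact mul_nonpos_of_nonneg_of_nonpos ht h0

theorem antitoneOn (hδ : IsMinFlow g δ) (hg : IsMonoSpeed M g) (h0 : g 0 ≤ 0) :
    AntitoneOn δ (Ici 0) := by
  intro s hs t ht hst
  have := hδ.sub_le_mul hg (c := 0) hs hst fun r hr _ =>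
    (hg.mono (hδ.nonpos h0 (le_trans hs hr))).trans h0
  linarith

end IsMinFlow

/-- Comparison with a margin: if `δ₁' ≤ δ₂'` whenever `δ₂ > δ₁ - r`, then a gap cannot open. -/
theorem le_of_integrands_le_of_gap {a₁ a₂ δ₁ δ₂ : ℝ → ℝ} {r : ℝ} (hr : 0 < r)
    (hi₁ : ∀ t, 0 ≤ t → IntervalIntegrable a₁ volume 0 t)
    (hi₂ : ∀ t, 0 ≤ t → IntervalIntegrable a₂ volume 0 t)
    (hc₁ : ContinuousOn δ₁ (Ici 0)) (hc₂ : ContinuousOn δ₂ (Ici 0))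
    (h₁ : ∀ t, 0 ≤ t → δ₁ t = ∫ s in (0 : ℝ)..t, a₁ s)
    (h₂ : ∀ t, 0 ≤ t → δ₂ t = ∫ s in (0 : ℝ)..t, a₂ s)
    (h : ∀ s, 0 ≤ s → δ₁ s - r < δ₂ s → a₁ s ≤ a₂ s) {t : ℝ} (ht : 0 ≤ t) : δ₁ t ≤ δ₂ t := by
  have key : ∀ T, 0 ≤ T → (∀ s, 0 ≤ s → s < T → δ₁ s - r < δ₂ s) → δ₁ T ≤ δ₂ T := by
    intro T hT hs
    rw [h₁ T hT, h₂ T hT]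
    refine intervalIntegral.integral_mono_on_of_le_Ioo hT (hi₁ T hT) (hi₂ T hT) fun s hs' => ?_
    exact h s hs'.1.le (hs s hs'.1.le hs'.2)
  -- The gap stays above `-r`: at a first time where it equals `-r` it would be nonnegative.
  refine key t ht fun s hs0 hst => ?_
  by_contra hcon
  push Not at hcon
  set B : Set ℝ := Icc 0 s ∩ {x | δ₂ x - δ₁ x ≤ -r}
  have hBc : IsCompact B := by
    have hcs : ContinuousOn (fun x => δ₂ x - δ₁ x) (Icc 0 s) :=
      (hc₂.sub hc₁).mono fun x hx => hx.1
    exact isCompact_Icc.of_isClosed_subset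
      (hcs.preimage_isClosed_of_isClosed isClosed_Icc isClosed_Iic) inter_subset_left
  have hBne : B.Nonempty := ⟨s, ⟨hs0, le_rfl⟩, by simp only [mem_ofPred_eq]; linarith⟩
  obtain ⟨T, hTB, hTmin⟩ := hBc.exists_isLeast hBne
  have h3 := key T hTB.1.1 fun x hx0 hxT => by
    by_contra hx
    push Not at hx
    exact absurd (hTmin ⟨⟨hx0, hxT.le.trans hTB.1.2⟩, by simp only [mem_ofPred_eq]; linarith⟩)
      (not_le.2 hxT)
  have h4 : δ₂ T - δ₁ T ≤ -r := hTB.2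
  linarith

namespace IsMinFlow

theorem nonneg (hδ : IsMinFlow g δ) (hg : IsMonoSpeed M g) {r : ℝ} (hr : 0 < r) (h0 : 0 ≤ g (-r))
    {t : ℝ} (ht : 0 ≤ t) : 0 ≤ δ t := by
  refine le_of_integrands_le_of_gap (δ₁ := fun _ => 0) (a₁ := fun _ => 0) hr
    (fun _ _ => intervalIntegrable_const)
    (fun t ht => hg.intervalIntegrable hδ.cont le_rfl ht) continuousOn_const hδ.cont
    (fun t _ => by simp) (fun t ht => hδ.eq_integral t ht) (fun s _ hs => ?_) ht
  exact h0.trans (hg.mono (by linarith))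

theorem monotoneOn (hδ : IsMinFlow g δ) (hg : IsMonoSpeed M g) {r : ℝ} (hr : 0 < r)
    (h0 : 0 ≤ g (-r)) : MonotoneOn δ (Ici 0) := by
  intro s hs t ht hst
  have := hδ.mul_le_sub hg (c := 0) hs hst fun x hx _ =>
    h0.trans (hg.mono (by linarith [hδ.nonneg hg hr h0 (le_trans hs hx)]))
  linarith

/-- A minimal flow either shrinks forever or grows forever. -/
theorem dichotomy (hδ : IsMinFlow g δ) (hg : IsMonoSpeed M g) :
    ((∀ t, 0 ≤ t → δ t ≤ 0) ∧ AntitoneOn δ (Ici 0)) ∨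
      ((∀ t, 0 ≤ t → 0 ≤ δ t) ∧ MonotoneOn δ (Ici 0)) := by
  rcases le_or_gt (g 0) 0 with h0 | h0
  · exact Or.inl ⟨fun t ht => hδ.nonpos h0 ht, hδ.antitoneOn hg h0⟩
  · have h1 : ∀ᶠ s in 𝓝[≤] (0 : ℝ), 0 < g s := (hg.left_cont 0).eventually (lt_mem_nhds h0)
    obtain ⟨s, hs, hs0⟩ := (h1.filter_mono (nhdsWithin_mono _ Iio_subset_Iic_self)).and
      (self_mem_nhdsWithin) |>.exists
    have hr : 0 < -s := by simpa using hs0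
    have h2 : 0 ≤ g (- -s) := by simpa using hs.le
    exact Or.inr ⟨fun t ht => hδ.nonneg hg hr h2 ht, hδ.monotoneOn hg hr h2⟩

theorem ae_hasDerivAt (hδ : IsMinFlow g δ) (hg : IsMonoSpeed M g) :
    ∀ᵐ t ∂(volume.restrict (Ici (0 : ℝ))), HasDerivAt δ (g (δ t)) t := by
  have hc : Continuous fun s => δ (max s 0) := by
    rw [← continuousOn_univ]
    exact hδ.cont.comp (by fun_prop) fun s _ => mem_Ici.2 (le_max_right s 0)
  have hli : LocallyIntegrable (fun s => g (δ (max s 0))) volume := by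
    refine (locallyIntegrable_const M).mono
      (hg.mono.measurable.comp hc.measurable).aestronglyMeasurable
      (Eventually.of_forall fun s => hg.norm_le _)
  have h1 := LocallyIntegrable.ae_hasDerivAt_integral hli
  rw [ae_restrict_iff' measurableSet_Ici]
  have h2 : ∀ᵐ t : ℝ, t ≠ 0 := by simp [ae_iff, measure_singleton]
  filter_upwards [h1, h2] with t ht ht0 htI
  have hpos : 0 < t := lt_of_le_of_ne htI (Ne.symm ht0)
  have h3 := ht 0
  rw [max_eq_left hpos.le] at h3
  refine h3.congr_of_eventuallyEq ?_
  filter_upwards [lt_mem_nhds hpos] with s hs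
  rw [hδ.eq_integral s hs.le]
  refine intervalIntegral.integral_congr fun x hx => ?_
  rw [uIcc_of_le hs.le] at hx
  simp [max_eq_left hx.1]

end IsMinFlow

/-- A Lipschitz function dominates the integral of any lower bound of its derivative. -/
theorem integral_le_of_ae_hasDerivAt {K : ℝ≥0} (hL : LipschitzOnWith K η (Ici 0)) (h0 : η 0 = 0)
    {a : ℝ → ℝ} {t : ℝ} (ht : 0 ≤ t) (hi : IntervalIntegrable a volume 0 t)
    (hd : ∀ᵐ s ∂(volume.restrict (Ici (0 : ℝ))), ∃ d, HasDerivAt η d s ∧ a s ≤ d) :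
    ∫ s in (0 : ℝ)..t, a s ≤ η t := by
  have hac : AbsolutelyContinuousOnInterval η 0 t :=
    (hL.mono fun x hx => by rw [uIcc_of_le ht] at hx; exact hx.1).absolutelyContinuousOnInterval
  have h1 := hac.integral_deriv_eq_sub
  rw [h0, sub_zero] at h1
  rw [← h1]
  refine intervalIntegral.integral_mono_ae_restrict ht hi hac.intervalIntegrable_deriv ?_
  have := ae_mono (Measure.restrict_mono (fun x (hx : x ∈ Icc (0 : ℝ) t) => hx.1 :
    Icc (0 : ℝ) t ⊆ Ici 0) (le_refl volume)) hd
  filter_upwards [this] with s hs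
  obtain ⟨d, hd, had⟩ := hs
  rw [hd.deriv]
  exact had

/-- The average of `g` over `[s, s + ρ]`, a continuous speed between `g` and its translate. -/
noncomputable def avgSpeed (ρ : ℝ) (g : ℝ → ℝ) (s : ℝ) : ℝ := ∫ θ in (0 : ℝ)..1, g (s + ρ * θ)

section avg

variable {ρ : ℝ}

theorem IsMonoSpeed.intervalIntegrable_affine (hg : IsMonoSpeed M g) (ρ s a b : ℝ) :
    IntervalIntegrable (fun θ => g (s + ρ * θ)) volume a b :=
  (intervalIntegrable_const (c := M)).mono_fun
    (hg.mono.measurable.comp (by fun_prop : Measurable fun θ => s + ρ * θ)).aestronglyMeasurable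
    (Eventually.of_forall fun s => hg.norm_le _)

theorem IsMonoSpeed.le_avgSpeed (hg : IsMonoSpeed M g) (hρ : 0 < ρ) (s : ℝ) :
    g s ≤ avgSpeed ρ g s := by
  have := intervalIntegral.integral_mono_on zero_le_one (intervalIntegrable_const (c := g s))
    (hg.intervalIntegrable_affine ρ s 0 1) fun θ hθ => hg.mono (by nlinarith [hθ.1])
  simpa [avgSpeed] using this

theorem IsMonoSpeed.avgSpeed_le (hg : IsMonoSpeed M g) (hρ : 0 < ρ) (s : ℝ) :
    avgSpeed ρ g s ≤ g (s + ρ) := by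
  have := intervalIntegral.integral_mono_on zero_le_one (hg.intervalIntegrable_affine ρ s 0 1)
    (intervalIntegrable_const (c := g (s + ρ))) fun θ hθ => hg.mono (by nlinarith [hθ.2])
  simpa [avgSpeed] using this

theorem IsMonoSpeed.continuous_avgSpeed (hg : IsMonoSpeed M g) (hρ : 0 < ρ) :
    Continuous (avgSpeed ρ g) := by
  have hi : ∀ a b, IntervalIntegrable g volume a b := fun a b => by
    simpa using hg.intervalIntegrable_affine 1 0 a b
  have hp := intervalIntegral.continuous_primitive hi 0
  have heq : avgSpeed ρ g = fun s =>
      ρ⁻¹ * ((∫ x in (0 : ℝ)..(s + ρ), g x) - ∫ x in (0 : ℝ)..s, g x) := by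
    funext s
    rw [intervalIntegral.integral_interval_sub_left (hi _ _) (hi _ _), avgSpeed,
      intervalIntegral.integral_comp_add_mul _ hρ.ne']
    simp
  rw [heq]
  exact continuous_const.mul ((hp.comp (by fun_prop)).sub hp)

theorem IsMonoSpeed.avg (hg : IsMonoSpeed M g) (hρ : 0 < ρ) : IsMonoSpeed M (avgSpeed ρ g) where
  mono s t hst := intervalIntegral.integral_mono_on zero_le_one
    (hg.intervalIntegrable_affine ρ s 0 1) (hg.intervalIntegrable_affine ρ t 0 1)
    fun θ _ => hg.mono (by linarith)
  left_cont s := (hg.continuous_avgSpeed hρ).continuousWithinAt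
  bound s := abs_le.2 ⟨(abs_le.1 (hg.bound s)).1.trans (hg.le_avgSpeed hρ s),
    (hg.avgSpeed_le hρ s).trans (abs_le.1 (hg.bound _)).2⟩

end avg

/-- With a continuous speed the flow is differentiable at every positive time. -/
theorem IsMinFlow.hasDerivAt (hδ : IsMinFlow g δ) (hg : IsMonoSpeed M g) (hc : Continuous g)
    {t : ℝ} (ht : 0 < t) : HasDerivAt δ (g (δ t)) t := by
  have hco : ContinuousOn (fun s => g (δ s)) (Ici 0) := hc.comp_continuousOn hδ.cont
  have h1 : HasDerivAt (fun x => ∫ s in (0 : ℝ)..x, g (δ s)) (g (δ t)) t := by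
    refine intervalIntegral.integral_hasDerivAt_right
      (hg.intervalIntegrable hδ.cont le_rfl ht.le) ?_ (hco.continuousAt (Ici_mem_nhds ht))
    exact (hco.mono Ioi_subset_Ici_self).stronglyMeasurableAtFilter isOpen_Ioi t ht
  refine h1.congr_of_eventuallyEq ?_
  filter_upwards [lt_mem_nhds ht] with s hs using hδ.eq_integral s hs.le

end NonlocalHJ

namespace NonlocalHJ

/-! ### Parallel sets -/

variable {n : ℕ}

section sd

variable {A B : Set (EuclideanSpace ℝ (Fin n))} {x y : EuclideanSpace ℝ (Fin n)} {s ρ r : ℝ}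

theorem sd_of_mem (hx : x ∈ A) : sd x A = -(Metric.infEDist x Aᶜ : EReal) := by
  simp [sd, Metric.infEDist_zero_of_mem hx]

theorem sd_of_notMem (hx : x ∉ A) : sd x A = (Metric.infEDist x A : EReal) := by
  simp [sd, Metric.infEDist_zero_of_mem (show x ∈ Aᶜ from hx)]

theorem sd_compl (x : EuclideanSpace ℝ (Fin n)) (A : Set (EuclideanSpace ℝ (Fin n))) :
    sd x Aᶜ = -sd x A := by
  by_cases hx : x ∈ A
  · rw [sd_of_mem hx, sd_of_notMem (not_not.2 hx), neg_neg]
  · rw [sd_of_notMem hx, sd_of_mem (show x ∈ Aᶜ from hx), compl_compl]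

theorem coe_ennreal_lt_coe_real (d : ℝ≥0∞) (hs : 0 ≤ s) :
    (d : EReal) < (s : EReal) ↔ d < ENNReal.ofReal s := by
  rw [← EReal.coe_ennreal_lt_coe_ennreal_iff, EReal.coe_ennreal_ofReal, max_eq_left hs]

theorem coe_real_lt_coe_ennreal (d : ℝ≥0∞) (hs : 0 ≤ s) :
    (s : EReal) < (d : EReal) ↔ ENNReal.ofReal s < d := by
  rw [← EReal.coe_ennreal_lt_coe_ennreal_iff, EReal.coe_ennreal_ofReal, max_eq_left hs]

theorem sd_lt_iff_of_pos (hs : 0 < s) : sd x A < (s : EReal) ↔ ∃ z ∈ A, dist x z < s := by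
  by_cases hx : x ∈ A
  · rw [sd_of_mem hx]
    refine iff_of_true ?_ ⟨x, hx, by simpa using hs⟩
    refine lt_of_le_of_lt ?_ (EReal.coe_pos.2 hs)
    rw [EReal.neg_le, neg_zero]
    exact EReal.coe_ennreal_nonneg _
  · rw [sd_of_notMem hx, coe_ennreal_lt_coe_real _ hs.le, Metric.infEDist_lt_iff]
    simp only [edist_dist, ENNReal.ofReal_lt_ofReal_iff hs]

theorem sd_lt_iff_of_nonpos (hs : s ≤ 0) :
    sd x A < (s : EReal) ↔ ∃ ρ, -s < ρ ∧ Metric.ball x ρ ⊆ A := by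
  have hs' : 0 ≤ -s := by linarith
  by_cases hx : x ∈ A
  · rw [sd_of_mem hx, EReal.neg_lt_comm, ← EReal.coe_neg, coe_real_lt_coe_ennreal _ hs']
    constructor
    · intro h
      obtain ⟨ρ, h1, h2⟩ := ENNReal.lt_iff_exists_nnreal_btwn.1 h
      refine ⟨ρ, ?_, fun y hy => ?_⟩
      · rwa [ENNReal.ofReal, ENNReal.coe_lt_coe, Real.toNNReal_lt_iff_lt_coe hs'] at h1
      · by_contra hyA
        have h3 := h2.trans_le (Metric.infEDist_le_edist_of_mem (show y ∈ Aᶜ from hyA) (x := x))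
        rw [Metric.mem_ball, dist_comm] at hy
        rw [edist_dist, ← ENNReal.ofReal_coe_nnreal,
          ENNReal.ofReal_lt_ofReal_iff_of_nonneg (NNReal.coe_nonneg ρ)] at h3
        exact absurd hy (not_lt.2 h3.le)
    · rintro ⟨ρ, h1, h2⟩
      refine lt_of_lt_of_le ((ENNReal.ofReal_lt_ofReal_iff_of_nonneg hs').2 h1) ?_
      rw [Metric.le_infEDist]
      intro y hy
      rw [edist_dist]
      refine ENNReal.ofReal_le_ofReal ?_
      by_contra hlt
      exact hy (h2 (by rw [Metric.mem_ball, dist_comm]; exact not_le.1 hlt))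
  · rw [sd_of_notMem hx]
    refine iff_of_false (not_lt.2 ?_) ?_
    · exact (EReal.coe_le_coe_iff.2 hs).trans (EReal.coe_ennreal_nonneg _)
    · rintro ⟨ρ, h1, h2⟩
      exact hx (h2 (Metric.mem_ball_self (by linarith)))

theorem sd_lt_mono (h : sd x A < (s : EReal)) (hs : s ≤ r) : sd x A < (r : EReal) :=
  h.trans_le (EReal.coe_le_coe_iff.2 hs)

theorem exists_sd_lt (h : sd x A < (s : EReal)) : ∃ r < s, sd x A < (r : EReal) := by
  obtain ⟨r, h1, h2⟩ := EReal.lt_iff_exists_real_btwn.1 h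
  exact ⟨r, EReal.coe_lt_coe_iff.1 h2, h1⟩

/-- If `B` contains the closed `r`-neighbourhood of `A`, the signed distances differ by `r`. -/
theorem sd_lt_sub_of_gap (hr : 0 ≤ r) (hAB : ∀ a ∈ A, ∀ y, dist a y ≤ r → y ∈ B)
    (h : sd x A < (s : EReal)) : sd x B < ((s - r : ℝ) : EReal) := by
  rcases lt_or_ge 0 s with hs | hs
  · obtain ⟨z, hz, hxz⟩ := (sd_lt_iff_of_pos hs).1 h
    rcases lt_or_ge r s with hrs | hrs
    · rw [sd_lt_iff_of_pos (by linarith)]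
      obtain ⟨y, hy1, hy2⟩ := exists_dist_lt_le (x := x) (z := z) (by linarith : 0 < s - r) hr
        (by linarith)
      exact ⟨y, hAB z hz y (by rwa [dist_comm]), hy1⟩
    · rw [sd_lt_iff_of_nonpos (by linarith)]
      refine ⟨r - dist x z, by linarith, fun y hy => hAB z hz y ?_⟩
      rw [Metric.mem_ball] at hy
      linarith [dist_triangle_right z y x, dist_comm x z]
  · obtain ⟨ρ, h1, h2⟩ := (sd_lt_iff_of_nonpos hs).1 h
    rw [sd_lt_iff_of_nonpos (by linarith)]
    refine ⟨ρ + r, by linarith, fun y hy => ?_⟩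
    rw [Metric.mem_ball, dist_comm] at hy
    obtain ⟨z, hz1, hz2⟩ := exists_dist_lt_le (by linarith : 0 < ρ) hr
      (by linarith : dist x y < r + ρ)
    exact hAB z (h2 (by rwa [Metric.mem_ball, dist_comm])) y hz2

theorem sd_lt_mono_set (hAB : A ⊆ B) (h : sd x A < (s : EReal)) : sd x B < (s : EReal) := by
  have := sd_lt_sub_of_gap (B := B) le_rfl (fun a ha y hy => by
    rw [← dist_le_zero.1 hy]
    exact hAB ha) h
  simpa using this

theorem sd_lt_add_of_dist_le (h : sd x A < (s : EReal)) (hxy : dist x y ≤ ρ) :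
    sd y A < ((s + ρ : ℝ) : EReal) := by
  have hρ : 0 ≤ ρ := dist_nonneg.trans hxy
  rcases lt_or_ge 0 s with hs | hs
  · obtain ⟨z, hz, hxz⟩ := (sd_lt_iff_of_pos hs).1 h
    rw [sd_lt_iff_of_pos (by linarith)]
    exact ⟨z, hz, by linarith [dist_triangle_left y z x]⟩
  · obtain ⟨ρ', h1, h2⟩ := (sd_lt_iff_of_nonpos hs).1 h
    rcases lt_or_ge 0 (s + ρ) with hsρ | hsρ
    · rw [sd_lt_iff_of_pos hsρ]
      obtain ⟨z, hz1, hz2⟩ := exists_dist_lt_lt (x := x) (z := y) (by linarith : 0 < ρ') hsρ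
        (by linarith)
      exact ⟨z, h2 (by rwa [Metric.mem_ball, dist_comm]), by rwa [dist_comm]⟩
    · rw [sd_lt_iff_of_nonpos hsρ]
      refine ⟨ρ' - ρ, by linarith, fun z hz => h2 ?_⟩
      rw [Metric.mem_ball] at hz ⊢
      linarith [dist_triangle z y x, dist_comm x y]

theorem isOpen_setOf_sd_lt (A : Set (EuclideanSpace ℝ (Fin n))) (s : ℝ) :
    IsOpen {x | sd x A < (s : EReal)} := by
  rw [Metric.isOpen_iff]
  intro x hx
  obtain ⟨r, hrs, hr⟩ := exists_sd_lt hx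
  refine ⟨s - r, by linarith, fun y hy => ?_⟩
  rw [Metric.mem_ball, dist_comm] at hy
  have := sd_lt_add_of_dist_le hr hy.le
  simpa using this

theorem exists_sd_lt_of_sd_lt_add (hs : 0 < s) (hρ : 0 ≤ ρ)
    (h : sd x A < ((s + ρ : ℝ) : EReal)) : ∃ y, dist x y ≤ ρ ∧ sd y A < (s : EReal) := by
  obtain ⟨z, hz, hxz⟩ := (sd_lt_iff_of_pos (by linarith)).1 h
  obtain ⟨y, hy1, hy2⟩ := exists_dist_le_lt hρ hs hxz
  exact ⟨y, hy1, (sd_lt_iff_of_pos hs).2 ⟨z, hz, hy2⟩⟩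

theorem sd_lt_iff_of_isOpen (hA : IsOpen A) (hρ : 0 ≤ ρ) :
    sd x A < (ρ : EReal) ↔ ∃ y, dist y x ≤ ρ ∧ y ∈ A := by
  rcases hρ.eq_or_lt with rfl | hρ
  · rw [sd_lt_iff_of_nonpos le_rfl, neg_zero]
    constructor
    · rintro ⟨ε, hε, hball⟩
      exact ⟨x, by simp, hball (Metric.mem_ball_self hε)⟩
    · rintro ⟨y, hyx, hy⟩
      rw [dist_le_zero.1 hyx] at hy
      exact Metric.isOpen_iff.1 hA x hy
  · rw [sd_lt_iff_of_pos hρ]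
    constructor
    · rintro ⟨z, hz, hxz⟩
      exact ⟨z, by rw [dist_comm]; exact hxz.le, hz⟩
    · rintro ⟨y, hyx, hy⟩
      obtain ⟨ε, hε, hball⟩ := Metric.isOpen_iff.1 hA y hy
      obtain ⟨z, hz1, hz2⟩ := exists_dist_lt_lt (x := y) (z := x) hε hρ (by linarith)
      exact ⟨z, hball (by rwa [Metric.mem_ball, dist_comm]), by rwa [dist_comm]⟩

theorem sd_lt_neg_iff_of_isOpen (hA : IsOpen A) (hρ : 0 ≤ ρ) :
    sd x A < ((-ρ : ℝ) : EReal) ↔ ∀ y, dist y x ≤ ρ → y ∈ A := by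
  rw [sd_lt_iff_of_nonpos (by linarith), neg_neg]
  constructor
  · rintro ⟨ρ', h1, h2⟩ y hy
    exact h2 (by rw [Metric.mem_ball]; linarith)
  · intro h
    obtain ⟨ε, hε, hsub⟩ := (isCompact_closedBall x ρ).exists_thickening_subset_open hA
      (fun y hy => h y hy)
    refine ⟨ε + ρ, by linarith, ?_⟩
    rwa [thickening_closedBall hε hρ] at hsub

/-- Retreating inside a set: a point at signed distance at least `s - ρ` has a point at signed
distance at least `s` within `ρ`, as long as `s ≤ 0`. -/
theorem exists_not_sd_lt_of_not_sd_lt_sub (hA : IsOpen A) (hs : s ≤ 0) (hρ : 0 ≤ ρ)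
    (h : ¬ sd x A < ((s - ρ : ℝ) : EReal)) :
    ∃ y, dist x y ≤ ρ ∧ ¬ sd y A < (s : EReal) := by
  rw [show s - ρ = -(ρ + -s) by ring, sd_lt_neg_iff_of_isOpen hA (by linarith)] at h
  push Not at h
  obtain ⟨z, hz, hzA⟩ := h
  rw [dist_comm] at hz
  obtain ⟨y, hy1, hy2⟩ := exists_dist_le_le hρ (by linarith : 0 ≤ -s)
    (by linarith : dist x z ≤ -s + ρ)
  refine ⟨y, hy1, fun hy => hzA ?_⟩
  rw [← neg_neg s, sd_lt_neg_iff_of_isOpen hA (by linarith)] at hy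
  exact hy z (by rwa [dist_comm])

end sd

variable {u₀ : EuclideanSpace ℝ (Fin n) → ℝ} {x : EuclideanSpace ℝ (Fin n)} {h h' s s' : ℝ}

theorem parD_mono (u₀ : EuclideanSpace ℝ (Fin n) → ℝ) (hh : h ≤ h') (hs : s ≤ s') :
    parD u₀ h s ⊆ parD u₀ h' s' := fun _ hx =>
  sd_lt_mono (sd_lt_mono_set (fun _ hy => lt_of_lt_of_le hy hh) hx) hs

theorem isOpen_parD (u₀ : EuclideanSpace ℝ (Fin n) → ℝ) (h s : ℝ) : IsOpen (parD u₀ h s) :=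
  isOpen_setOf_sd_lt _ _

/-- The complement of a closed parallel set is an open parallel set of `-u₀`. -/
theorem compl_parE (u₀ : EuclideanSpace ℝ (Fin n) → ℝ) (h s : ℝ) :
    (parE u₀ h s)ᶜ = parD (fun x => -u₀ x) (-h) (-s) := by
  ext x
  have : {y | -u₀ y < -h} = {y | u₀ y ≤ h}ᶜ := by
    ext y
    simp
  simp only [parE, parD, mem_compl_iff, mem_ofPred_eq, this, sd_compl, not_le]
  rw [EReal.neg_lt_comm, ← EReal.coe_neg, neg_neg]

theorem mem_parD_zero (hu : Continuous u₀) : x ∈ parD u₀ h 0 ↔ u₀ x < h := by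
  have hA : IsOpen {y | u₀ y < h} := isOpen_lt hu continuous_const
  simp only [parD, mem_ofPred_eq]
  rw [sd_lt_iff_of_isOpen hA le_rfl]
  constructor
  · rintro ⟨y, hy, h⟩
    rwa [dist_le_zero.1 hy] at h
  · exact fun h => ⟨x, by simp, h⟩

/-- Uniform continuity separates two levels by a distance `r`, which the parallel sets keep. -/
theorem exists_parD_gap (hu : UniformContinuous u₀) (hh : h < h') :
    ∃ r > 0, ∀ a b s, h' - h ≤ b - a → parD u₀ a s ⊆ parD u₀ b (s - r) := by
  obtain ⟨r, hr, hur⟩ := Metric.uniformContinuous_iff.1 hu (h' - h) (by linarith)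
  refine ⟨r / 2, by linarith, fun a b s hab x hx => ?_⟩
  refine sd_lt_sub_of_gap (by linarith) (fun z hz y hy => ?_) hx
  have h1 := hur (show dist z y < r by linarith)
  rw [Real.dist_eq] at h1
  have h2 := (abs_lt.1 h1).1
  simp only [mem_ofPred_eq] at hz ⊢
  linarith

theorem exists_mem_parD_lt (hx : x ∈ parD u₀ h s) : ∃ r < s, x ∈ parD u₀ h r :=
  exists_sd_lt hx

end NonlocalHJ

namespace NonlocalHJ

/-! ### Propagation along characteristics for viscosity subsolutions -/

/-- The `C¹` penalty `max(s, 0)²`. -/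
noncomputable def posSq (s : ℝ) : ℝ := max s 0 ^ 2

theorem posSq_nonneg (s : ℝ) : 0 ≤ posSq s := sq_nonneg _

theorem posSq_of_nonpos {s : ℝ} (hs : s ≤ 0) : posSq s = 0 := by simp [posSq, max_eq_right hs]

theorem sq_le_posSq {r s : ℝ} (hr : 0 ≤ r) (h : r ≤ s) : r ^ 2 ≤ posSq s :=
  pow_le_pow_left₀ hr (h.trans (le_max_left _ _)) 2

theorem hasDerivAt_posSq (s : ℝ) : HasDerivAt posSq (2 * max s 0) s := by
  rcases lt_trichotomy s 0 with hs | rfl | hs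
  · rw [max_eq_right hs.le, mul_zero]
    refine (hasDerivAt_const s (0 : ℝ)).congr_of_eventuallyEq ?_
    filter_upwards [gt_mem_nhds hs] with r hr using posSq_of_nonpos (le_of_lt hr)
  · rw [max_self, mul_zero, hasDerivAt_iff_isLittleO_nhds_zero]
    have h1 : (fun h : ℝ => posSq (0 + h) - posSq 0 - h • (0 : ℝ)) =O[𝓝 0] fun h : ℝ => h ^ 2 := by
      refine Asymptotics.IsBigO.of_bound 1 (Eventually.of_forall fun h => ?_)
      simp only [zero_add, posSq, max_self, smul_zero, sub_zero, norm_pow, Real.norm_eq_abs,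
        one_mul]
      rw [zero_pow two_ne_zero, sub_zero, abs_pow, sq_abs, sq_abs]
      rcases max_cases h 0 with ⟨h1, _⟩ | ⟨h1, _⟩ <;> rw [h1]
      simpa using sq_nonneg h
    exact h1.trans_isLittleO (by simpa using Asymptotics.isLittleO_pow_id (one_lt_two))
  · have h1 : HasDerivAt (fun r : ℝ => r ^ 2) (2 * max s 0) s := by
      rw [max_eq_left hs.le]
      simpa using hasDerivAt_pow 2 s
    refine h1.congr_of_eventuallyEq ?_
    filter_upwards [lt_mem_nhds hs] with r hr
    simp [posSq, max_eq_left (le_of_lt hr)]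

theorem contDiff_posSq : ContDiff ℝ 1 posSq := by
  rw [contDiff_one_iff_deriv]
  refine ⟨fun s => (hasDerivAt_posSq s).differentiableAt, ?_⟩
  rw [show deriv posSq = fun s => 2 * max s 0 from funext fun s => (hasDerivAt_posSq s).deriv]
  fun_prop

variable {n : ℕ}

/-- A smoothed norm `√(‖z‖² + ε²)`. -/
noncomputable def smoothNorm (ε : ℝ) (z : EuclideanSpace ℝ (Fin n)) : ℝ := √(‖z‖ ^ 2 + ε ^ 2)

section smoothNorm

variable {ε : ℝ} {z : EuclideanSpace ℝ (Fin n)}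

theorem smoothNorm_pos (hε : 0 < ε) (z : EuclideanSpace ℝ (Fin n)) : 0 < smoothNorm ε z :=
  Real.sqrt_pos.2 (by positivity)

theorem norm_le_smoothNorm (ε : ℝ) (z : EuclideanSpace ℝ (Fin n)) : ‖z‖ ≤ smoothNorm ε z :=
  Real.le_sqrt_of_sq_le (by nlinarith [sq_nonneg ε])

theorem smoothNorm_le (hε : 0 < ε) (z : EuclideanSpace ℝ (Fin n)) : smoothNorm ε z ≤ ‖z‖ + ε :=
  Real.sqrt_le_iff.2 ⟨by positivity, by nlinarith [norm_nonneg z]⟩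

theorem contDiff_smoothNorm (hε : 0 < ε) :
    ContDiff ℝ 1 (smoothNorm ε : EuclideanSpace ℝ (Fin n) → ℝ) :=
  (((contDiff_id.norm_sq ℝ).add contDiff_const).sqrt fun z => by
    have : 0 < ‖z‖ ^ 2 + ε ^ 2 := by positivity
    exact this.ne')

theorem hasGradientAt_smoothNorm (hε : 0 < ε) (z : EuclideanSpace ℝ (Fin n)) :
    HasGradientAt (smoothNorm ε) ((smoothNorm ε z)⁻¹ • z) z := by
  have h0 : ‖z‖ ^ 2 + ε ^ 2 ≠ 0 := by positivity
  have h1 := ((hasFDerivAt_id (𝕜 := ℝ) z).norm_sq.add_const (ε ^ 2)).sqrt h0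
  rw [hasGradientAt_iff_hasFDerivAt]
  refine h1.congr_fderiv ?_
  ext w
  simp [smoothNorm]
  field_simp

end smoothNorm

/-- The penalty used to localize near the backward characteristic `y = c + E(t)`, widened by
`ρ - κ(t)`. -/
noncomputable def barrier (ε K η ρ T : ℝ) (c : EuclideanSpace ℝ (Fin n))
    (E : ℝ → EuclideanSpace ℝ (Fin n)) (κ : ℝ → ℝ) (y : EuclideanSpace ℝ (Fin n)) (t : ℝ) : ℝ :=
  K * posSq (smoothNorm ε (y - c - E t) + κ t - ρ) + K * posSq (t - T) + η * t

section barrier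

variable {ε K η ρ T : ℝ} {c : EuclideanSpace ℝ (Fin n)} {E E' : ℝ → EuclideanSpace ℝ (Fin n)}
  {κ κ' : ℝ → ℝ}

theorem contDiffOn_barrier (hε : 0 < ε) (hE : ContDiffOn ℝ 1 E (Ioi 0))
    (hκ : ContDiffOn ℝ 1 κ (Ioi 0)) :
    ContDiffOn ℝ 1 (fun z : EuclideanSpace ℝ (Fin n) × ℝ => barrier ε K η ρ T c E κ z.1 z.2)
      (univ ×ˢ Ioi 0) := by
  have h2 : MapsTo (Prod.snd : EuclideanSpace ℝ (Fin n) × ℝ → ℝ) (univ ×ˢ Ioi 0) (Ioi 0) :=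
    fun z hz => hz.2
  have hE2 : ContDiffOn ℝ 1 (fun z : EuclideanSpace ℝ (Fin n) × ℝ => E z.2) (univ ×ˢ Ioi 0) :=
    hE.comp contDiff_snd.contDiffOn h2
  have hκ2 : ContDiffOn ℝ 1 (fun z : EuclideanSpace ℝ (Fin n) × ℝ => κ z.2) (univ ×ˢ Ioi 0) :=
    hκ.comp contDiff_snd.contDiffOn h2
  have h3 : ContDiffOn ℝ 1 (fun z : EuclideanSpace ℝ (Fin n) × ℝ =>
      smoothNorm ε (z.1 - c - E z.2) + κ z.2 - ρ) (univ ×ˢ Ioi 0) :=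
    (((contDiff_smoothNorm hε).comp_contDiffOn
      ((contDiff_fst.contDiffOn.sub contDiffOn_const).sub hE2)).add hκ2).sub contDiffOn_const
  refine ((contDiffOn_const.mul (contDiff_posSq.comp_contDiffOn h3)).add
    (contDiffOn_const.mul (contDiff_posSq.comp_contDiffOn
      (contDiff_snd.contDiffOn.sub contDiffOn_const)))).add
    (contDiffOn_const.mul contDiff_snd.contDiffOn)

theorem hasDerivAt_barrier (hε : 0 < ε) {t : ℝ} (hE : HasDerivAt E (E' t) t)
    (hκ : HasDerivAt κ (κ' t) t) (y : EuclideanSpace ℝ (Fin n)) :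
    HasDerivAt (fun t => barrier ε K η ρ T c E κ y t)
      (K * (2 * max (smoothNorm ε (y - c - E t) + κ t - ρ) 0 *
        (-inner ℝ ((smoothNorm ε (y - c - E t))⁻¹ • (y - c - E t)) (E' t) + κ' t))
        + K * (2 * max (t - T) 0) + η) t := by
  have h1 : HasDerivAt (fun t => smoothNorm ε (y - c - E t))
      (-inner ℝ ((smoothNorm ε (y - c - E t))⁻¹ • (y - c - E t)) (E' t)) t := by
    have := (hasGradientAt_smoothNorm hε (y - c - E t)).hasFDerivAt.comp_hasDerivAt t
      ((hasDerivAt_const t (y - c)).sub hE)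
    refine this.congr_deriv ?_
    rw [zero_sub, map_neg, InnerProductSpace.toDual_apply_apply]
  have h2 := (hasDerivAt_posSq _).comp t ((h1.add hκ).sub_const ρ)
  have h3 := (hasDerivAt_posSq _).comp t ((hasDerivAt_id t).sub_const T)
  refine (((h2.const_mul K).add (h3.const_mul K)).add
    ((hasDerivAt_id t).const_mul η)).congr_deriv ?_
  simp

theorem hasGradientAt_barrier (hε : 0 < ε) (t : ℝ) (y : EuclideanSpace ℝ (Fin n)) :
    HasGradientAt (fun y => barrier ε K η ρ T c E κ y t)
      ((K * (2 * max (smoothNorm ε (y - c - E t) + κ t - ρ) 0)) •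
        ((smoothNorm ε (y - c - E t))⁻¹ • (y - c - E t))) y := by
  have h1 : HasFDerivAt (fun y : EuclideanSpace ℝ (Fin n) => smoothNorm ε (y - c - E t)) _ y :=
    HasFDerivAt.comp (g := smoothNorm ε) y
      (hasGradientAt_smoothNorm hε (y - c - E t)).hasFDerivAt
      (((hasFDerivAt_id (𝕜 := ℝ) y).sub_const c).sub_const (E t))
  have h2 := (hasDerivAt_posSq _).comp_hasFDerivAt y ((h1.add_const (κ t)).sub_const ρ)
  have h3 := ((h2.const_mul K).add_const (K * posSq (t - T))).add_const (η * t)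
  rw [hasGradientAt_iff_hasFDerivAt]
  refine h3.congr_fderiv ?_
  ext w
  simp
  ring

/-- The barrier is a strict supersolution of the eikonal equation with drift `E'` and speed `κ'`. -/
theorem barrier_strict (hε : 0 < ε) (hK : 0 ≤ K) {t : ℝ} (hE : HasDerivAt E (E' t) t)
    (hκ : HasDerivAt κ (κ' t) t) (hκ0 : 0 ≤ κ' t) (y : EuclideanSpace ℝ (Fin n)) :
    η ≤ deriv (fun t => barrier ε K η ρ T c E κ y t) t
      + inner ℝ (E' t) (gradient (fun y => barrier ε K η ρ T c E κ y t) y)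
      - κ' t * ‖gradient (fun y => barrier ε K η ρ T c E κ y t) y‖ := by
  rw [(hasDerivAt_barrier hε hE hκ y).deriv, (hasGradientAt_barrier hε t y).gradient]
  set S := smoothNorm ε (y - c - E t) with hS
  set z := y - c - E t with hz
  have hSpos : 0 < S := smoothNorm_pos hε z
  have hzS : ‖S⁻¹ • z‖ ≤ 1 := by
    rw [norm_smul, norm_inv, Real.norm_of_nonneg hSpos.le, inv_mul_le_iff₀ hSpos, mul_one]
    exact norm_le_smoothNorm ε z
  set p := S⁻¹ • z
  set q := max (S + κ t - ρ) 0
  have hq : 0 ≤ q := le_max_right _ _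
  have hT : 0 ≤ max (t - T) 0 := le_max_right _ _
  rw [inner_smul_right, norm_smul, Real.norm_of_nonneg (by positivity : 0 ≤ K * (2 * q)),
    real_inner_comm]
  have h1 : κ' t * (K * (2 * q) * ‖p‖) ≤ κ' t * (K * (2 * q) * 1) := by gcongr
  have h2 : 0 ≤ K * (2 * max (t - T) 0) := by positivity
  linarith

end barrier

theorem continuous_slice {v : EuclideanSpace ℝ (Fin n) → ℝ → ℝ}
    (hv : ContinuousOn (fun z : EuclideanSpace ℝ (Fin n) × ℝ => v z.1 z.2) (univ ×ˢ Ici 0))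
    {t : ℝ} (ht : 0 ≤ t) : Continuous fun y => v y t := by
  rw [← continuousOn_univ]
  exact hv.comp (by fun_prop : Continuous fun y => (y, t)).continuousOn fun y _ => ⟨mem_univ _, ht⟩

/-- **Propagation along characteristics.** Above the level `m`, let `v` be a subsolution of
`v_t + E' · ∇v - κ' |∇v| ≤ 0`. If `v ≤ m` at time `a` on the ball of dependence of `(x, b)`, then
`v(x, b) ≤ m`. -/
theorem le_of_propagation {v : EuclideanSpace ℝ (Fin n) → ℝ → ℝ}
    {E E' : ℝ → EuclideanSpace ℝ (Fin n)} {κ κ' : ℝ → ℝ} {a b m : ℝ}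
    {x : EuclideanSpace ℝ (Fin n)}
    (hv : ContinuousOn (fun z : EuclideanSpace ℝ (Fin n) × ℝ => v z.1 z.2) (univ ×ˢ Ici 0))
    (ha : 0 ≤ a) (hab : a ≤ b)
    (hE : ContDiffOn ℝ 1 E (Ioi 0)) (hE0 : ContinuousOn E (Ici 0))
    (hE' : ∀ t, 0 < t → HasDerivAt E (E' t) t)
    (hκ : ContDiffOn ℝ 1 κ (Ioi 0)) (hκ0 : ContinuousOn κ (Ici 0)) (hκm : MonotoneOn κ (Ici 0))
    (hκ' : ∀ t, 0 < t → HasDerivAt κ (κ' t) t) (hκn : ∀ t, 0 < t → 0 ≤ κ' t)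
    (htest : ∀ (φ : EuclideanSpace ℝ (Fin n) → ℝ → ℝ) (x₀ : EuclideanSpace ℝ (Fin n)) (t₀ : ℝ),
      ContDiffOn ℝ 1 (fun z : EuclideanSpace ℝ (Fin n) × ℝ => φ z.1 z.2) (univ ×ˢ Ioi 0) →
      a < t₀ → t₀ < b →
      IsLocalMax (fun z : EuclideanSpace ℝ (Fin n) × ℝ => v z.1 z.2 - φ z.1 z.2) (x₀, t₀) →
      m < v x₀ t₀ →
      deriv (fun t => φ x₀ t) t₀ + inner ℝ (E' t₀) (gradient (fun x => φ x t₀) x₀)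
        - κ' t₀ * ‖gradient (fun x => φ x t₀) x₀‖ ≤ 0)
    (hinit : ∀ y, ‖y - (x - E b) - E a‖ ≤ κ b - κ a → v y a ≤ m) : v x b ≤ m := by
  rcases hab.eq_or_lt with rfl | hab
  · exact hinit x (by simp)
  by_contra hcon
  push Not at hcon
  set c := x - E b with hc
  set γ := (v x b - m) / 4 with hγ
  have hγ0 : 0 < γ := by rw [hγ]; linarith
  have hb : 0 < b := ha.trans_lt hab
  have hκab : κ a ≤ κ b := hκm ha hb.le hab.le
  have hvx : ContinuousOn (fun t => v x t) (Ici 0) :=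
    hv.comp (by fun_prop : Continuous fun t => (x, t)).continuousOn fun t ht => ⟨mem_univ _, ht⟩
  -- Widen the ball of dependence slightly.
  obtain ⟨ρ, hρ, hball⟩ : ∃ ρ > 0, ∀ y, ‖y - c - E a‖ < κ b - κ a + 2 * ρ → v y a < m + γ := by
    have hopen : IsOpen {y | v y a < m + γ} := isOpen_lt (continuous_slice hv ha) continuous_const
    obtain ⟨δ, hδ, hsub⟩ :=
      (isCompact_closedBall (c + E a) (κ b - κ a)).exists_thickening_subset_open hopen (fun y hy => by
        have := hinit y (by rwa [mem_closedBall_iff_norm, ← sub_sub] at hy)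
        simp only [mem_ofPred_eq]
        linarith)
    rw [thickening_closedBall hδ (by linarith)] at hsub
    refine ⟨δ / 2, by linarith, fun y hy => hsub ?_⟩
    rw [mem_ball_iff_norm, ← sub_sub]
    linarith
  -- A time just before `b` at which `v(x, ·)` is still large and the characteristic is close.
  obtain ⟨T, haT, hTb, hET, hvT⟩ :
      ∃ T, a < T ∧ T < b ∧ ‖E b - E T‖ < ρ / 2 ∧ m + 3 * γ < v x T := by
    have h1 : Tendsto (fun t => ‖E b - E t‖) (𝓝[<] b) (𝓝 0) := by
      have : ContinuousAt E b := hE0.continuousAt (Ici_mem_nhds hb)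
      have h2 : Tendsto (fun t => ‖E b - E t‖) (𝓝 b) (𝓝 ‖E b - E b‖) :=
        (tendsto_const_nhds.sub this).norm
      rw [sub_self, norm_zero] at h2
      exact h2.mono_left nhdsWithin_le_nhds
    have h3 : Tendsto (fun t => v x t) (𝓝[<] b) (𝓝 (v x b)) :=
      (hvx.continuousAt (Ici_mem_nhds hb)).tendsto.mono_left nhdsWithin_le_nhds
    have h4 : ∀ᶠ t in 𝓝[<] b, a < t ∧ t < b := Ioo_mem_nhdsLT hab
    obtain ⟨T, h5, h6, h7⟩ := (h4.and ((h1.eventually (gt_mem_nhds (half_pos hρ))).and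
      (h3.eventually (lt_mem_nhds (show m + 3 * γ < v x b by rw [hγ]; linarith))))).exists
    exact ⟨T, h5.1, h5.2, h6, h7⟩
  -- A compact cylinder containing all the points that matter.
  obtain ⟨CE, hCE⟩ : ∃ CE, ∀ t ∈ Icc a b, ‖E t - E b‖ ≤ CE :=
    isCompact_Icc.exists_bound_of_continuousOn
      ((hE0.mono fun t ht => ha.trans ht.1).sub continuousOn_const)
  set R := CE + (κ b - κ a) + 2 * ρ with hR
  have hCE0 : 0 ≤ CE := (norm_nonneg _).trans (hCE b ⟨hab.le, le_rfl⟩)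
  set Q := Metric.closedBall x R ×ˢ Icc a b
  have hQ : IsCompact Q := (isCompact_closedBall x R).prod isCompact_Icc
  have hQ0 : Q ⊆ univ ×ˢ Ici 0 := fun z hz => ⟨mem_univ _, ha.trans hz.2.1⟩
  obtain ⟨V, hV⟩ := hQ.exists_bound_of_continuousOn (hv.mono hQ0)
  have hVle : ∀ z ∈ Q, v z.1 z.2 ≤ V := fun z hz => (le_abs_self _).trans (hV z hz)
  set D := |V - m| + 1
  have hD : V - m < D := (le_abs_self _).trans_lt (lt_add_one _)
  have hD0 : 0 ≤ D := by positivity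
  set K := D / ρ ^ 2 + D / (b - T) ^ 2
  have hbT : 0 < b - T := by linarith
  have hK0 : 0 ≤ K := by positivity
  have hK1 : D ≤ K * ρ ^ 2 := by
    have : D = D / ρ ^ 2 * ρ ^ 2 := by field_simp
    have h2 : 0 ≤ D / (b - T) ^ 2 * ρ ^ 2 := by positivity
    simp only [K]
    linarith
  have hK2 : D ≤ K * (b - T) ^ 2 := by
    have : D = D / (b - T) ^ 2 * (b - T) ^ 2 := by field_simp
    have h2 : 0 ≤ D / ρ ^ 2 * (b - T) ^ 2 := by positivity
    simp only [K]
    linarith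
  set η := γ / (b + 1)
  have hη : 0 < η := by positivity
  have hηb : η * b ≤ γ := by
    simp only [η]
    rw [div_mul_eq_mul_div, div_le_iff₀ (by linarith)]
    nlinarith
  set φ := barrier (ρ / 2) K η (κ b + ρ) T c E κ with hφ
  have hφC := contDiffOn_barrier (K := K) (η := η) (ρ := κ b + ρ) (T := T) (c := c)
    (half_pos hρ) hE hκ
  have hφc : ContinuousOn (fun z : EuclideanSpace ℝ (Fin n) × ℝ => φ z.1 z.2) Q := by
    have h2 : MapsTo (Prod.snd : EuclideanSpace ℝ (Fin n) × ℝ → ℝ) Q (Ici 0) :=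
      fun z hz => ha.trans hz.2.1
    have hE2 : ContinuousOn (fun z : EuclideanSpace ℝ (Fin n) × ℝ => E z.2) Q :=
      hE0.comp continuousOn_snd h2
    have hκ2 : ContinuousOn (fun z : EuclideanSpace ℝ (Fin n) × ℝ => κ z.2) Q :=
      hκ0.comp continuousOn_snd h2
    have h3 := (contDiff_smoothNorm (n := n) (half_pos hρ)).continuous
    have h4 := contDiff_posSq.continuous
    have h5 : ContinuousOn (fun z : EuclideanSpace ℝ (Fin n) × ℝ =>
        smoothNorm (ρ / 2) (z.1 - c - E z.2) + κ z.2 - (κ b + ρ)) Q :=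
      ((h3.comp_continuousOn ((continuousOn_fst.sub continuousOn_const).sub hE2)).add hκ2).sub
        continuousOn_const
    exact ((continuousOn_const.mul (h4.comp_continuousOn h5)).add
      (continuousOn_const.mul (h4.comp_continuousOn (continuousOn_snd.sub continuousOn_const)))).add
      (continuousOn_const.mul continuousOn_snd)
  have hxT : ((x, T) : EuclideanSpace ℝ (Fin n) × ℝ) ∈ Q :=
    ⟨Metric.mem_closedBall_self (by rw [hR]; linarith), haT.le, hTb.le⟩
  obtain ⟨⟨y, t⟩, hyt, hmax⟩ := hQ.exists_isMaxOn ⟨_, hxT⟩ ((hv.mono hQ0).sub hφc)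
  have hφT : φ x T ≤ γ := by
    have h1 : smoothNorm (ρ / 2) (x - c - E T) ≤ ρ := by
      refine (smoothNorm_le (half_pos hρ) _).trans ?_
      rw [hc, sub_sub_cancel]
      linarith
    have h2 : κ T ≤ κ b := hκm (ha.trans haT.le) hb.le hTb.le
    have h3 : η * T ≤ η * b := by gcongr
    rw [hφ, barrier, posSq_of_nonpos (by linarith), posSq_of_nonpos (by linarith)]
    linarith
  have hval : m + 2 * γ < v y t - φ y t := by
    have : v x T - φ x T ≤ v y t - φ y t := hmax hxT
    linarith
  have hφyt : φ y t = K * posSq (smoothNorm (ρ / 2) (y - c - E t) + κ t - (κ b + ρ))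
    + K * posSq (t - T) + η * t := rfl
  have ht0 : 0 ≤ t := ha.trans hyt.2.1
  have hηt : 0 ≤ η * t := by positivity
  -- Outside the widened characteristic tube the penalty exceeds the oscillation of `v`.
  have htube : smoothNorm (ρ / 2) (y - c - E t) + κ t - (κ b + ρ) < ρ := by
    by_contra hge
    push Not at hge
    have h1 := mul_le_mul_of_nonneg_left (sq_le_posSq hρ.le hge) hK0
    have h2 := mul_nonneg hK0 (posSq_nonneg (t - T))
    have := hVle _ hyt
    simp only at this
    linarith
  have htb : t < b := by
    refine lt_of_le_of_ne hyt.2.2 fun h => ?_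
    have h1 := mul_le_mul_of_nonneg_left (sq_le_posSq hbT.le (show b - T ≤ t - T by rw [h])) hK0
    have h2 := mul_nonneg hK0 (posSq_nonneg (smoothNorm (ρ / 2) (y - c - E t) + κ t - (κ b + ρ)))
    have := hVle _ hyt
    simp only at this
    linarith
  have hφ0 : 0 ≤ φ y t := by
    have h1 := mul_nonneg hK0 (posSq_nonneg (smoothNorm (ρ / 2) (y - c - E t) + κ t - (κ b + ρ)))
    have h2 := mul_nonneg hK0 (posSq_nonneg (t - T))
    linarith
  have hnorm := norm_le_smoothNorm (ρ / 2) (y - c - E t)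
  have hta : a < t := by
    refine lt_of_le_of_ne hyt.2.1 fun h => ?_
    rw [← h] at htube hnorm hval hφ0
    have := hball y (by linarith)
    linarith
  have hyR : dist y x < R := by
    have h1 : κ a ≤ κ t := hκm ha ht0 hta.le
    have h2 := hCE t hyt.2
    have h3 : y - x = (y - c - E t) + (E t - E b) := by rw [hc]; abel
    rw [dist_eq_norm, h3]
    have h4 := norm_add_le (y - c - E t) (E t - E b)
    linarith
  have hloc :
      IsLocalMax (fun z : EuclideanSpace ℝ (Fin n) × ℝ => v z.1 z.2 - φ z.1 z.2) (y, t) := by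
    refine hmax.isLocalMax (prod_mem_nhds ?_ (Icc_mem_nhds hta htb))
    exact mem_of_superset (Metric.isOpen_ball.mem_nhds hyR) Metric.ball_subset_closedBall
  have htpos : 0 < t := ha.trans_lt hta
  have h1 := htest φ y t hφC hta htb hloc (by linarith)
  have h2 := barrier_strict (K := K) (η := η) (ρ := κ b + ρ) (T := T) (c := c) (half_pos hρ) hK0
    (hE' t htpos) (hκ' t htpos) (hκn t htpos) y
  linarith

end NonlocalHJ

namespace NonlocalHJ

/-! ### Nonlocal speed laws and the level-set representation -/

variable {n : ℕ}

/-- A speed law assigns to a level `h` and a set `S` (the sublevel set) a normal speed `c h S`. It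
is monotone in both arguments, bounded, and continuous along increasing levels and increasing open
sets. -/
structure IsSpeedLaw (M : ℝ) (c : ℝ → Set (EuclideanSpace ℝ (Fin n)) → ℝ) : Prop where
  mono : ∀ {h h' : ℝ} {S S' : Set (EuclideanSpace ℝ (Fin n))}, h ≤ h' → S ⊆ S' → c h S ≤ c h' S'
  bound : ∀ h S, |c h S| ≤ M
  tendsto : ∀ (a : ℕ → ℝ) (h : ℝ) (S : ℕ → Set (EuclideanSpace ℝ (Fin n))), Monotone a →
    Tendsto a atTop (𝓝 h) → Monotone S → (∀ k, IsOpen (S k)) →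
    Tendsto (fun k => c (a k) (S k)) atTop (𝓝 (c h (⋃ k, S k)))

/-- The viscosity subsolution test for `v_t + |∇v| c(v, {v(·, t) < v(x, t)}) = 0`. -/
def IsTestSub (c : ℝ → Set (EuclideanSpace ℝ (Fin n)) → ℝ)
    (v : EuclideanSpace ℝ (Fin n) → ℝ → ℝ) : Prop :=
  ∀ (φ : EuclideanSpace ℝ (Fin n) → ℝ → ℝ) (x₀ : EuclideanSpace ℝ (Fin n)) (t₀ : ℝ),
    ContDiffOn ℝ 1 (fun z : EuclideanSpace ℝ (Fin n) × ℝ => φ z.1 z.2) (univ ×ˢ Ioi 0) →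
    0 < t₀ →
    IsLocalMax (fun z : EuclideanSpace ℝ (Fin n) × ℝ => v z.1 z.2 - φ z.1 z.2) (x₀, t₀) →
    deriv (fun t => φ x₀ t) t₀ + ‖gradient (fun x => φ x t₀) x₀‖ *
      c (v x₀ t₀) {y | v y t₀ < v x₀ t₀} ≤ 0

/-- `δ h` is, for every level `h`, the minimal flow driving the sets `parD u₀ h (δ h t)`. -/
def IsFlowFamily (c : ℝ → Set (EuclideanSpace ℝ (Fin n)) → ℝ)
    (u₀ : EuclideanSpace ℝ (Fin n) → ℝ) (δ : ℝ → ℝ → ℝ) : Prop :=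
  ∀ h, IsMinFlow (fun s => c h (parD u₀ h s)) (δ h)

/-- The function whose strict sublevel set at level `h` and time `t` is essentially
`parD u₀ h (δ h t)`. -/
noncomputable def levelSup (δ : ℝ → ℝ → ℝ) (u₀ : EuclideanSpace ℝ (Fin n) → ℝ)
    (x : EuclideanSpace ℝ (Fin n)) (t : ℝ) : ℝ :=
  sSup {h | x ∉ parD u₀ h (δ h t)}

variable {M : ℝ} {c : ℝ → Set (EuclideanSpace ℝ (Fin n)) → ℝ}
  {u₀ : EuclideanSpace ℝ (Fin n) → ℝ} {δ : ℝ → ℝ → ℝ}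
  {x y : EuclideanSpace ℝ (Fin n)} {h h' s t : ℝ}

theorem tendsto_sub_inv_nat (h : ℝ) :
    Tendsto (fun k : ℕ => h - 1 / ((k : ℝ) + 1)) atTop (𝓝 h) := by
  simpa using tendsto_const_nhds.sub (tendsto_one_div_add_atTop_nhds_zero_nat (𝕜 := ℝ))

theorem monotone_sub_inv_nat (h : ℝ) : Monotone fun k : ℕ => h - 1 / ((k : ℝ) + 1) := by
  intro i j hij
  have : 1 / ((j : ℝ) + 1) ≤ 1 / ((i : ℝ) + 1) :=
    one_div_le_one_div_of_le (by positivity) (by exact_mod_cast Nat.succ_le_succ hij)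
  simp only
  linarith

theorem sub_inv_nat_lt (h : ℝ) (k : ℕ) : h - 1 / ((k : ℝ) + 1) < h := by
  have : (0 : ℝ) < 1 / ((k : ℝ) + 1) := by positivity
  linarith

theorem IsSpeedLaw.isMonoSpeed (hc : IsSpeedLaw M c) (u₀ : EuclideanSpace ℝ (Fin n) → ℝ) (h : ℝ) :
    IsMonoSpeed M fun s => c h (parD u₀ h s) where
  mono _ _ hst := hc.mono le_rfl (parD_mono u₀ le_rfl hst)
  bound _ := hc.bound _ _
  left_cont s := by
    have hU : ⋃ k : ℕ, parD u₀ h (s - 1 / ((k : ℝ) + 1)) = parD u₀ h s := by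
      refine Subset.antisymm (iUnion_subset fun k => parD_mono u₀ le_rfl (sub_inv_nat_lt s k).le) ?_
      intro x hx
      obtain ⟨r, hrs, hr⟩ := exists_mem_parD_lt hx
      obtain ⟨k, hk⟩ := ((tendsto_sub_inv_nat s).eventually (lt_mem_nhds hrs)).exists
      exact mem_iUnion.2 ⟨k, parD_mono u₀ le_rfl hk.le hr⟩
    have h1 := hc.tendsto (fun _ => h) h (fun k : ℕ => parD u₀ h (s - 1 / ((k : ℝ) + 1)))
      monotone_const tendsto_const_nhds
      (fun i j hij => parD_mono u₀ le_rfl (monotone_sub_inv_nat s hij))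
      (fun k => isOpen_parD u₀ h _)
    rw [hU] at h1
    refine tendsto_order.2 ⟨fun a ha => ?_, fun a ha => ?_⟩
    · obtain ⟨k, hk⟩ := (h1.eventually (lt_mem_nhds ha)).exists
      filter_upwards [mem_nhdsWithin_of_mem_nhds (lt_mem_nhds (sub_inv_nat_lt s k))] with r hr
      exact hk.trans_le (hc.mono le_rfl (parD_mono u₀ le_rfl hr.le))
    · filter_upwards [self_mem_nhdsWithin] with r hr
      exact (hc.mono le_rfl (parD_mono u₀ le_rfl hr)).trans_lt ha

theorem IsSpeedLaw.exists_isFlowFamily (hc : IsSpeedLaw M c)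
    (u₀ : EuclideanSpace ℝ (Fin n) → ℝ) : ∃ δ, IsFlowFamily c u₀ δ :=
  Classical.axiom_of_choice fun h => (hc.isMonoSpeed u₀ h).exists_isMinFlow

namespace IsFlowFamily

theorem mono (hδ : IsFlowFamily c u₀ δ) (hc : IsSpeedLaw M c) (hh : h ≤ h') (ht : 0 ≤ t) :
    δ h t ≤ δ h' t := by
  refine (hδ h).le_of_super (δ h') (hδ h').cont (fun t ht => ?_) t ht
  rw [(hδ h').eq_integral t ht]
  exact intervalIntegral.integral_mono_on ht
    ((hc.isMonoSpeed u₀ h).intervalIntegrable (hδ h').cont le_rfl ht)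
    ((hc.isMonoSpeed u₀ h').intervalIntegrable (hδ h').cont le_rfl ht)
    fun s _ => hc.mono hh (parD_mono u₀ hh le_rfl)

theorem parD_subset (hδ : IsFlowFamily c u₀ δ) (hc : IsSpeedLaw M c) (hh : h ≤ h') (ht : 0 ≤ t) :
    parD u₀ h (δ h t) ⊆ parD u₀ h' (δ h' t) :=
  parD_mono u₀ hh (hδ.mono hc hh ht)

theorem mem_parD_of_forall_lt (hδ : IsFlowFamily c u₀ δ) (hc : IsSpeedLaw M c)
    (hu : Continuous u₀) (ht : 0 ≤ t) (hb : ∀ y, dist y x ≤ M * t → u₀ y < h) :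
    x ∈ parD u₀ h (δ h t) := by
  have hM : 0 ≤ M * t := mul_nonneg (hc.isMonoSpeed u₀ h).bound_nonneg ht
  have h1 := (abs_le.1 ((hδ h).abs_le (hc.isMonoSpeed u₀ h) ht)).1
  exact parD_mono u₀ le_rfl h1
    ((sd_lt_neg_iff_of_isOpen (isOpen_lt hu continuous_const) hM).2 hb)

theorem notMem_parD_of_forall_le (hδ : IsFlowFamily c u₀ δ) (hc : IsSpeedLaw M c)
    (hu : Continuous u₀) (ht : 0 ≤ t) (hb : ∀ y, dist y x ≤ M * t → h ≤ u₀ y) :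
    x ∉ parD u₀ h (δ h t) := by
  have hM : 0 ≤ M * t := mul_nonneg (hc.isMonoSpeed u₀ h).bound_nonneg ht
  have h1 := (abs_le.1 ((hδ h).abs_le (hc.isMonoSpeed u₀ h) ht)).2
  intro hx
  obtain ⟨y, hy1, hy2⟩ := (sd_lt_iff_of_isOpen (isOpen_lt hu continuous_const) hM).1
    (parD_mono u₀ le_rfl h1 hx)
  exact absurd (hb y hy1) (not_le.2 hy2)

theorem mem_upperBounds (hδ : IsFlowFamily c u₀ δ) (hc : IsSpeedLaw M c) (ht : 0 ≤ t)
    (hx : x ∈ parD u₀ h (δ h t)) : h ∈ upperBounds {h | x ∉ parD u₀ h (δ h t)} := by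
  intro a ha
  by_contra hlt
  exact ha (hδ.parD_subset hc (not_le.1 hlt).le ht hx)

theorem exists_abs_le_on_ball (M : ℝ) (hu : Continuous u₀) (x : EuclideanSpace ℝ (Fin n)) (t : ℝ) :
    ∃ C, ∀ y, dist y x ≤ M * t → |u₀ y| ≤ C :=
  (isCompact_closedBall x (M * t)).exists_bound_of_continuousOn hu.continuousOn

theorem isLUB_levelSup (hδ : IsFlowFamily c u₀ δ) (hc : IsSpeedLaw M c) (hu : Continuous u₀)
    (x : EuclideanSpace ℝ (Fin n)) (ht : 0 ≤ t) :
    IsLUB {h | x ∉ parD u₀ h (δ h t)} (levelSup δ u₀ x t) := by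
  obtain ⟨C, hC⟩ := exists_abs_le_on_ball M hu x t
  refine isLUB_csSup ⟨-C, ?_⟩ ⟨C + 1, ?_⟩
  · exact hδ.notMem_parD_of_forall_le hc hu ht fun y hy => (abs_le.1 (hC y hy)).1
  · exact hδ.mem_upperBounds hc ht (hδ.mem_parD_of_forall_lt hc hu ht fun y hy => by
      linarith [(abs_le.1 (hC y hy)).2])

theorem levelSup_le (hδ : IsFlowFamily c u₀ δ) (hc : IsSpeedLaw M c) (hu : Continuous u₀)
    (ht : 0 ≤ t) (hx : x ∈ parD u₀ h (δ h t)) : levelSup δ u₀ x t ≤ h :=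
  (hδ.isLUB_levelSup hc hu x ht).2 (hδ.mem_upperBounds hc ht hx)

theorem le_levelSup (hδ : IsFlowFamily c u₀ δ) (hc : IsSpeedLaw M c) (hu : Continuous u₀)
    (ht : 0 ≤ t) (hx : x ∉ parD u₀ h (δ h t)) : h ≤ levelSup δ u₀ x t :=
  (hδ.isLUB_levelSup hc hu x ht).1 hx

theorem mem_parD_of_lt (hδ : IsFlowFamily c u₀ δ) (hc : IsSpeedLaw M c) (hu : Continuous u₀)
    (ht : 0 ≤ t) (hx : levelSup δ u₀ x t < h) : x ∈ parD u₀ h (δ h t) := by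
  by_contra hcon
  exact absurd (hδ.le_levelSup hc hu ht hcon) (not_le.2 hx)

theorem notMem_parD_of_lt (hδ : IsFlowFamily c u₀ δ) (hc : IsSpeedLaw M c) (hu : Continuous u₀)
    (ht : 0 ≤ t) (hx : h < levelSup δ u₀ x t) : x ∉ parD u₀ h (δ h t) := fun hcon =>
  absurd (hδ.levelSup_le hc hu ht hcon) (not_le.2 hx)

theorem abs_levelSup_le (hδ : IsFlowFamily c u₀ δ) (hc : IsSpeedLaw M c) (hu : Continuous u₀)
    (ht : 0 ≤ t) {C : ℝ} (hC : ∀ y, dist y x ≤ M * t → |u₀ y| ≤ C) : |levelSup δ u₀ x t| ≤ C := by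
  refine abs_le.2 ⟨?_, le_of_forall_gt_imp_ge_of_dense fun a ha => ?_⟩
  · exact hδ.le_levelSup hc hu ht (hδ.notMem_parD_of_forall_le hc hu ht fun y hy =>
      (abs_le.1 (hC y hy)).1)
  · exact hδ.levelSup_le hc hu ht (hδ.mem_parD_of_forall_lt hc hu ht fun y hy =>
      ((abs_le.1 (hC y hy)).2).trans_lt ha)

theorem levelSup_zero (hδ : IsFlowFamily c u₀ δ) (hu : Continuous u₀)
    (x : EuclideanSpace ℝ (Fin n)) : levelSup δ u₀ x 0 = u₀ x := by
  have : {h | x ∉ parD u₀ h (δ h 0)} = Iic (u₀ x) := by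
    ext h
    simp [(hδ h).zero, mem_parD_zero hu]
  rw [levelSup, this, csSup_Iic]

/-- The gap between two levels, which is preserved by the flow, turns uniform continuity of `u₀`
into uniform continuity in space and time. -/
theorem exists_levelSup_le_add (hδ : IsFlowFamily c u₀ δ) (hc : IsSpeedLaw M c)
    (hu : UniformContinuous u₀) {ε : ℝ} (hε : 0 < ε) :
    ∃ r > 0, ∀ x y s t, 0 ≤ s → 0 ≤ t → dist x y < r → |t - s| < r →
      levelSup δ u₀ x t ≤ levelSup δ u₀ y s + ε := by
  have hM : 0 ≤ M := (hc.isMonoSpeed u₀ 0).bound_nonneg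
  obtain ⟨r, hr, hgap⟩ := exists_parD_gap hu (half_pos hε)
  refine ⟨r / (1 + M), by positivity, fun x y s t hs ht hxy hts => ?_⟩
  set h₁ := levelSup δ u₀ y s + ε / 2 with hh₁
  have h1 : y ∈ parD u₀ h₁ (δ h₁ s) :=
    hδ.mem_parD_of_lt hc hu.continuous hs (by rw [hh₁]; linarith)
  have h2 := hgap h₁ (h₁ + ε / 2) _ (by linarith) h1
  rw [dist_comm] at hxy
  have h3 : x ∈ parD u₀ (h₁ + ε / 2) (δ h₁ s - r + r / (1 + M)) := sd_lt_add_of_dist_le h2 hxy.le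
  have h4 := (abs_le.1 ((hδ h₁).abs_sub_le (hc.isMonoSpeed u₀ h₁) ht hs)).2
  have h5 : M * |s - t| ≤ M * (r / (1 + M)) := by
    rw [abs_sub_comm]
    gcongr
  have h6 : r / (1 + M) + M * (r / (1 + M)) = r := by field_simp
  have h7 := hδ.mono hc (by linarith : h₁ ≤ h₁ + ε / 2) ht
  have h8 := hδ.levelSup_le hc hu.continuous ht (parD_mono u₀ le_rfl
    (show δ h₁ s - r + r / (1 + M) ≤ δ (h₁ + ε / 2) t by linarith) h3)
  linarith

theorem abs_levelSup_sub_le (hδ : IsFlowFamily c u₀ δ) (hc : IsSpeedLaw M c)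
    (hu : UniformContinuous u₀) {ε : ℝ} (hε : 0 < ε) :
    ∃ r > 0, ∀ x y s t, 0 ≤ s → 0 ≤ t → dist x y < r → |t - s| < r →
      |levelSup δ u₀ x t - levelSup δ u₀ y s| ≤ ε := by
  obtain ⟨r, hr, H⟩ := hδ.exists_levelSup_le_add hc hu hε
  refine ⟨r, hr, fun x y s t hs ht hxy hts => abs_le.2 ⟨?_, ?_⟩⟩
  · have := H y x t s ht hs (by rwa [dist_comm]) (by rwa [abs_sub_comm])
    linarith
  · have := H x y s t hs ht hxy hts
    linarith

theorem continuousOn_levelSup (hδ : IsFlowFamily c u₀ δ) (hc : IsSpeedLaw M c)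
    (hu : UniformContinuous u₀) :
    ContinuousOn (fun z : EuclideanSpace ℝ (Fin n) × ℝ => levelSup δ u₀ z.1 z.2)
      (univ ×ˢ Ici 0) := by
  rw [Metric.continuousOn_iff]
  rintro ⟨y, s⟩ hs ε hε
  obtain ⟨r, hr, H⟩ := hδ.abs_levelSup_sub_le hc hu (half_pos hε)
  refine ⟨r, hr, fun z hz hzd => ?_⟩
  rw [Prod.dist_eq, max_lt_iff] at hzd
  rw [Real.dist_eq]
  have := H z.1 y s z.2 hs.2 hz.2 hzd.1 (by rw [← Real.dist_eq]; exact hzd.2)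
  simp only
  linarith

end IsFlowFamily

/-! ### The representation is a viscosity subsolution -/

/-- A calculus criterion: if backward in time there are points, moved by at most `|c| τ`, where `w`
has not dropped, then every `C¹` function touching `w` from above satisfies the eikonal inequality
with speed `c`. -/
theorem deriv_add_norm_gradient_mul_le {w φ : EuclideanSpace ℝ (Fin n) → ℝ → ℝ}
    {x₀ : EuclideanSpace ℝ (Fin n)} {t₀ c : ℝ}
    (hφ : DifferentiableAt ℝ (fun z : EuclideanSpace ℝ (Fin n) × ℝ => φ z.1 z.2) (x₀, t₀))
    (hmax : IsLocalMax (fun z : EuclideanSpace ℝ (Fin n) × ℝ => w z.1 z.2 - φ z.1 z.2) (x₀, t₀))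
    (H : ∀ ε > 0, ∀ᶠ τ in 𝓝[>] (0 : ℝ), ∃ x, ‖x - x₀‖ ≤ |c| * τ ∧
      inner ℝ (gradient (fun x => φ x t₀) x₀) (x - x₀)
        ≤ -(c * τ * ‖gradient (fun x => φ x t₀) x₀‖) ∧
      w x₀ t₀ - ε * τ ≤ w x (t₀ - τ)) :
    deriv (fun t => φ x₀ t) t₀ + ‖gradient (fun x => φ x t₀) x₀‖ * c ≤ 0 := by
  set p := gradient (fun x => φ x t₀) x₀ with hp
  set q := deriv (fun t => φ x₀ t) t₀ with hq
  obtain ⟨L, hL⟩ := hφ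
  have hLp : ∀ w, L (w, 0) = inner ℝ p w := by
    intro w
    have h1 : HasFDerivAt (fun x => φ x t₀) (L.comp (ContinuousLinearMap.inl ℝ _ ℝ)) x₀ :=
      HasFDerivAt.comp (g := fun z : EuclideanSpace ℝ (Fin n) × ℝ => φ z.1 z.2)
        (f := fun x => (x, t₀)) x₀ hL
        (hasFDerivAt_prodMk_left x₀ t₀)
    have h2 := h1.differentiableAt.hasGradientAt.hasFDerivAt.unique h1
    have h3 := congrArg (fun A => A w) h2
    simpa [hp] using h3.symm
  have hLq : ∀ τ : ℝ, L (0, τ) = τ * q := by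
    intro τ
    have h1 : HasFDerivAt (fun t => φ x₀ t) (L.comp (ContinuousLinearMap.inr ℝ _ ℝ)) t₀ :=
      HasFDerivAt.comp (g := fun z : EuclideanSpace ℝ (Fin n) × ℝ => φ z.1 z.2)
        (f := fun t => (x₀, t)) t₀ hL
        (hasFDerivAt_prodMk_right x₀ t₀)
    have h2 := h1.hasDerivAt.deriv
    have h3 : L (0, τ) = τ • L (0, 1) := by rw [← map_smul]; simp
    rw [h3, hq, h2]
    simp
  have key : ∀ ε > 0, q + ‖p‖ * c ≤ ε * (|c| + 2) := by
    intro ε hε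
    have hlo := hL.isLittleO.def hε
    obtain ⟨r, hr, hball⟩ := Metric.eventually_nhds_iff.1 (hlo.and hmax)
    have hsmall : ∀ᶠ τ in 𝓝[>] (0 : ℝ), (|c| + 1) * τ < r := by
      have : Tendsto (fun τ : ℝ => (|c| + 1) * τ) (𝓝[>] 0) (𝓝 ((|c| + 1) * 0)) :=
        ((continuous_const.mul continuous_id).tendsto 0).mono_left nhdsWithin_le_nhds
      rw [mul_zero] at this
      exact this.eventually (gt_mem_nhds hr)
    obtain ⟨τ, ⟨⟨x, hx1, hx2, hx3⟩, hτr⟩, hτ⟩ :=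
      (((H ε hε).and hsmall).and self_mem_nhdsWithin).exists
    have hτ0 : 0 < τ := hτ
    have hnorm : ‖((x, t₀ - τ) : EuclideanSpace ℝ (Fin n) × ℝ) - (x₀, t₀)‖ ≤ (|c| + 1) * τ := by
      rw [Prod.mk_sub_mk, Prod.norm_mk]
      refine max_le ?_ ?_
      · nlinarith
      · rw [sub_sub_cancel_left, norm_neg, Real.norm_of_nonneg hτ0.le]
        nlinarith [abs_nonneg c]
    obtain ⟨h1, h2⟩ := hball (y := (x, t₀ - τ)) (by rw [dist_eq_norm]; linarith)
    have h3 : L ((x, t₀ - τ) - (x₀, t₀)) = inner ℝ p (x - x₀) - τ * q := by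
      rw [Prod.mk_sub_mk, sub_sub_cancel_left,
        show ((x - x₀, -τ) : EuclideanSpace ℝ (Fin n) × ℝ) = (x - x₀, 0) + (0, -τ) by simp,
        map_add, hLp, hLq]
      ring
    rw [h3] at h1
    have h4 := (abs_le.1 (h1.trans (mul_le_mul_of_nonneg_left hnorm hε.le))).2
    simp only at h2 h4
    have h5 : (q + ‖p‖ * c) * τ ≤ (ε * (|c| + 2)) * τ := by nlinarith
    exact le_of_mul_le_mul_right h5 hτ0
  refine le_of_forall_gt_imp_ge_of_dense fun a ha => ?_
  have := key (a / (|c| + 2)) (by positivity)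
  rwa [div_mul_cancel₀ _ (by positivity)] at this

namespace IsFlowFamily

/-- A point outside the set at time `t₀` comes from a point outside at an earlier time, moved along
any prescribed direction when the set grows, or at controlled distance when it shrinks. -/
theorem exists_backward_point (hδ : IsFlowFamily c u₀ δ) (hc : IsSpeedLaw M c)
    (hu : Continuous u₀) {x₀ : EuclideanSpace ℝ (Fin n)} {t₀ τ c₁ : ℝ} (ht : 0 ≤ t₀ - τ)
    (hτ : 0 ≤ τ) (hx₀ : x₀ ∉ parD u₀ h (δ h t₀)) (hc₁ : c₁ * τ ≤ δ h t₀ - δ h (t₀ - τ))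
    (p : EuclideanSpace ℝ (Fin n)) :
    ∃ x, ‖x - x₀‖ ≤ |c₁| * τ ∧ inner ℝ p (x - x₀) ≤ -(c₁ * τ * ‖p‖) ∧
      x ∉ parD u₀ h (δ h (t₀ - τ)) := by
  rcases le_or_gt 0 c₁ with h0 | h0
  · have hρ : 0 ≤ c₁ * τ := mul_nonneg h0 hτ
    have hn : ‖‖p‖⁻¹ • p‖ ≤ 1 := by
      rw [norm_smul, norm_inv, norm_norm]
      exact inv_mul_le_one
    have hd : ‖(x₀ - (c₁ * τ) • (‖p‖⁻¹ • p)) - x₀‖ ≤ c₁ * τ := by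
      rw [sub_sub_cancel_left, norm_neg, norm_smul, Real.norm_of_nonneg hρ]
      exact mul_le_of_le_one_right hρ hn
    refine ⟨x₀ - (c₁ * τ) • (‖p‖⁻¹ • p), ?_, ?_, fun hx => hx₀ ?_⟩
    · rwa [abs_of_nonneg h0]
    · rw [sub_sub_cancel_left, inner_neg_right, inner_smul_right, inner_smul_right,
        real_inner_self_eq_norm_sq, neg_le_neg_iff]
      rcases eq_or_ne ‖p‖ 0 with hp | hp
      · simp [hp]
      · exact le_of_eq (by field_simp)
    · exact parD_mono u₀ le_rfl (by linarith) 
        (sd_lt_add_of_dist_le (ρ := c₁ * τ) hx (by rwa [dist_eq_norm]))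
  · rcases le_or_gt (δ h (t₀ - τ)) (δ h t₀) with hR | hR
    · refine ⟨x₀, by simpa using mul_nonneg (abs_nonneg _) hτ, ?_,
        fun hx => hx₀ (parD_mono u₀ le_rfl hR hx)⟩
      rw [sub_self, inner_zero_right, neg_nonneg]
      exact mul_nonpos_of_nonpos_of_nonneg (mul_nonpos_of_nonpos_of_nonneg h0.le hτ) (norm_nonneg _)
    · have hneg : δ h (t₀ - τ) ≤ 0 := by
        rcases (hδ h).dichotomy (hc.isMonoSpeed u₀ h) with h1 | h1
        · exact h1.1 _ ht
        · exact absurd (h1.2 ht (show (0 : ℝ) ≤ t₀ by linarith) (by linarith)) (not_le.2 hR)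
      obtain ⟨y, hy1, hy2⟩ := exists_not_sd_lt_of_not_sd_lt_sub
        (isOpen_lt hu continuous_const : IsOpen {y | u₀ y < h}) hneg
        (by linarith : 0 ≤ δ h (t₀ - τ) - δ h t₀) (x := x₀) (by rwa [sub_sub_cancel])
      rw [dist_comm, dist_eq_norm] at hy1
      refine ⟨y, ?_, ?_, hy2⟩
      · rw [abs_of_neg h0]
        linarith
      · have h1 := real_inner_le_norm p (y - x₀)
        have h2 : ‖p‖ * ‖y - x₀‖ ≤ ‖p‖ * (-(c₁ * τ)) := by
          gcongr
          linarith
        linarith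

/-- The speed of the levels slightly below `u(x₀, t₀)`, at times close to `t₀`, is at least the
speed in the equation, up to `ε`. -/
theorem exists_speed_ge (hδ : IsFlowFamily c u₀ δ) (hc : IsSpeedLaw M c)
    (hu : UniformContinuous u₀) {t₀ : ℝ} (ht₀ : 0 ≤ t₀) (h₀ : ℝ) {ε : ℝ} (hε : 0 < ε) :
    ∃ h₁ < h₀, ∃ r > 0, ∀ h, h₁ ≤ h → ∀ s, 0 ≤ s → |s - t₀| < r →
      c h₀ {y | levelSup δ u₀ y t₀ < h₀} - ε ≤ c h (parD u₀ h (δ h s)) := by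
  have hcont := continuous_slice (hδ.continuousOn_levelSup hc hu) ht₀
  have hU : ⋃ k : ℕ, {y | levelSup δ u₀ y t₀ < h₀ - 1 / ((k : ℝ) + 1)}
      = {y | levelSup δ u₀ y t₀ < h₀} := by
    ext y
    simp only [mem_iUnion, mem_ofPred_eq]
    exact ⟨fun ⟨k, hk⟩ => hk.trans (sub_inv_nat_lt h₀ k),
      fun hy => ((tendsto_sub_inv_nat h₀).eventually (lt_mem_nhds hy)).exists⟩
  have h1 := hc.tendsto (fun k : ℕ => h₀ - 1 / ((k : ℝ) + 1)) h₀
    (fun k : ℕ => {y | levelSup δ u₀ y t₀ < h₀ - 1 / ((k : ℝ) + 1)})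
    (monotone_sub_inv_nat h₀) (tendsto_sub_inv_nat h₀)
    (fun i j hij y hy => lt_of_lt_of_le hy (monotone_sub_inv_nat h₀ hij))
    (fun k => isOpen_lt hcont continuous_const)
  rw [hU] at h1
  obtain ⟨k, hk⟩ := (h1.eventually (lt_mem_nhds (sub_lt_self _ hε))).exists
  set a := h₀ - 1 / ((k : ℝ) + 1)
  have ha : a < h₀ := sub_inv_nat_lt h₀ k
  obtain ⟨r, hr, H⟩ := hδ.exists_levelSup_le_add hc hu (show 0 < (h₀ - a) / 2 by linarith)
  refine ⟨(a + h₀) / 2, by linarith, r, hr, fun h hh s hs hsr => ?_⟩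
  refine hk.le.trans (hc.mono (by linarith) fun y hy => ?_)
  have h2 := H y y t₀ s ht₀ hs (by simpa using hr) hsr
  simp only [mem_ofPred_eq] at hy
  exact hδ.mem_parD_of_lt hc hu.continuous hs (by linarith)

theorem isTestSub_levelSup (hδ : IsFlowFamily c u₀ δ) (hc : IsSpeedLaw M c)
    (hu : UniformContinuous u₀) : IsTestSub c (levelSup δ u₀) := by
  intro φ x₀ t₀ hφ ht₀ hmax
  have hφd : DifferentiableAt ℝ (fun z : EuclideanSpace ℝ (Fin n) × ℝ => φ z.1 z.2) (x₀, t₀) :=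
    (hφ.differentiableOn one_ne_zero).differentiableAt
      (prod_mem_nhds univ_mem (Ioi_mem_nhds ht₀))
  set h₀ := levelSup δ u₀ x₀ t₀ with hh₀
  set p := gradient (fun x => φ x t₀) x₀ with hp
  set q := deriv (fun t => φ x₀ t) t₀
  set c₀ := c h₀ {y | levelSup δ u₀ y t₀ < h₀}
  have key : ∀ ε > 0, q + ‖p‖ * (c₀ - ε) ≤ 0 := by
    intro ε hε
    obtain ⟨h₁, hh₁, r, hr, hspeed⟩ := hδ.exists_speed_ge hc hu ht₀.le h₀ hε
    refine deriv_add_norm_gradient_mul_le hφd hmax fun ε' hε' => ?_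
    have hlt : ∀ a : ℝ, 0 < a → ∀ᶠ τ in 𝓝[>] (0 : ℝ), τ < a := fun a ha =>
      mem_nhdsWithin_of_mem_nhds (gt_mem_nhds ha)
    filter_upwards [hlt r hr, hlt t₀ ht₀, hlt ((h₀ - h₁) / ε') (div_pos (by linarith) hε'),
      self_mem_nhdsWithin] with τ hτr hτt hτh hτ
    have hτ0 : 0 < τ := hτ
    rw [lt_div_iff₀ hε'] at hτh
    have hετ : 0 < ε' * τ := mul_pos hε' hτ0
    set h := h₀ - ε' * τ with hh
    have hinc : (c₀ - ε) * τ ≤ δ h t₀ - δ h (t₀ - τ) := by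
      have := (hδ h).mul_le_sub (hc.isMonoSpeed u₀ h) (c := c₀ - ε) (s := t₀ - τ) (t := t₀)
        (by linarith) (by linarith) fun s hs1 hs2 => hspeed h (by rw [hh]; linarith) s (by linarith)
          (by rw [abs_lt]; constructor <;> linarith)
      simpa using this
    obtain ⟨x, hx1, hx2, hx3⟩ := hδ.exists_backward_point hc hu.continuous (h := h) (x₀ := x₀)
      (by linarith) hτ0.le
      (hδ.notMem_parD_of_lt hc hu.continuous ht₀.le (by rw [← hh₀, hh]; linarith)) hinc p
    exact ⟨x, hx1, hx2, hδ.le_levelSup hc hu.continuous (by linarith) hx3⟩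
  refine le_of_forall_gt_imp_ge_of_dense fun a ha => ?_
  have h1 := key (a / (‖p‖ + 1)) (by positivity)
  have h2 : ‖p‖ * (a / (‖p‖ + 1)) ≤ a := by
    rw [← mul_div_assoc, div_le_iff₀ (by positivity)]
    nlinarith [norm_nonneg p]
  linarith

end IsFlowFamily

end NonlocalHJ

namespace NonlocalHJ

/-! ### Comparison of subsolutions with the representation -/

variable {n : ℕ} {M : ℝ} {c : ℝ → Set (EuclideanSpace ℝ (Fin n)) → ℝ}
  {u₀ : EuclideanSpace ℝ (Fin n) → ℝ} {δ : ℝ → ℝ → ℝ} {v : EuclideanSpace ℝ (Fin n) → ℝ → ℝ}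

/-- Above a level `m` whose sublevel sets contain `S t`, a subsolution moves at speed at least
`c m (S t)`. -/
theorem IsTestSub.le_of_mem_subset (hsub : IsTestSub c v) (hc : IsSpeedLaw M c) {m h : ℝ}
    (hm : h ≤ m) {S : Set (EuclideanSpace ℝ (Fin n))} {φ : EuclideanSpace ℝ (Fin n) → ℝ → ℝ}
    {x₀ : EuclideanSpace ℝ (Fin n)} {t₀ : ℝ} (hS : ∀ y ∈ S, v y t₀ ≤ m)
    (hφ : ContDiffOn ℝ 1 (fun z : EuclideanSpace ℝ (Fin n) × ℝ => φ z.1 z.2) (univ ×ˢ Ioi 0))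
    (ht₀ : 0 < t₀)
    (hmax : IsLocalMax (fun z : EuclideanSpace ℝ (Fin n) × ℝ => v z.1 z.2 - φ z.1 z.2) (x₀, t₀))
    (hv : m < v x₀ t₀) :
    deriv (fun t => φ x₀ t) t₀ + ‖gradient (fun x => φ x t₀) x₀‖ * c h S ≤ 0 := by
  have h1 := hsub φ x₀ t₀ hφ ht₀ hmax
  have h2 : c h S ≤ c (v x₀ t₀) {y | v y t₀ < v x₀ t₀} :=
    hc.mono (hm.trans hv.le) fun y hy => lt_of_le_of_lt (hS y hy) hv
  have h3 := mul_le_mul_of_nonneg_left h2 (norm_nonneg (gradient (fun x => φ x t₀) x₀))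
  linarith

/-- Finite speed of propagation. -/
theorem IsTestSub.le_of_finite_speed (hsub : IsTestSub c v) (hc : IsSpeedLaw M c)
    (hv : ContinuousOn (fun z : EuclideanSpace ℝ (Fin n) × ℝ => v z.1 z.2) (univ ×ˢ Ici 0))
    {a b m : ℝ} (ha : 0 ≤ a) (hab : a ≤ b) {x : EuclideanSpace ℝ (Fin n)}
    (hinit : ∀ y, dist x y ≤ M * (b - a) → v y a ≤ m) : v x b ≤ m := by
  have hM : 0 ≤ M := (abs_nonneg _).trans (hc.bound 0 ∅)
  refine le_of_propagation (E := fun _ => 0) (E' := fun _ => 0) (κ := fun t => M * t)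
    (κ' := fun _ => M) hv ha hab contDiffOn_const continuousOn_const
    (fun t _ => hasDerivAt_const t _) (by fun_prop) (by fun_prop)
    (fun s _ t _ hst => mul_le_mul_of_nonneg_left hst hM)
    (fun t _ => by simpa using (hasDerivAt_id t).const_mul M) (fun _ _ => hM) ?_ ?_
  · intro φ x₀ t₀ hφ h1 h2 hmax hm
    have h3 := hsub.le_of_mem_subset hc le_rfl (S := ∅) (by simp) hφ (ha.trans_lt h1) hmax hm
    have h4 := mul_le_mul_of_nonneg_left (abs_le.1 (hc.bound m ∅)).1
      (norm_nonneg (gradient (fun x => φ x t₀) x₀))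
    rw [inner_zero_left]
    linarith
  · intro y hy
    refine hinit y ?_
    rw [dist_comm, dist_eq_norm]
    simpa [mul_sub] using hy

theorem nonneg_of_hasDerivAt_of_monotoneOn {θ : ℝ → ℝ} {d t : ℝ} (hθ : MonotoneOn θ (Ici 0))
    (ht : 0 < t) (hd : HasDerivAt θ d t) : 0 ≤ d := by
  rw [← hd.hasDerivWithinAt.derivWithin (uniqueDiffOn_Ici 0 t ht.le)]
  exact hθ.derivWithin_nonneg

/-- A front with continuous speed `δ' = ĝ(δ)` that is overtaken by the sublevel set `{v ≤ m}` with a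
margin `r` stays overtaken with the same margin. The margin absorbs the discontinuity of
`s ↦ c h (parD u₀ h s)`: half of it bounds the speed of `{v ≤ m}` from below by `ĝ`, the other half
keeps the inclusion valid on a time step whose length does not depend on the starting time. -/
theorem IsTestSub.front_step (hsub : IsTestSub c v) (hc : IsSpeedLaw M c)
    (hv : ContinuousOn (fun z : EuclideanSpace ℝ (Fin n) × ℝ => v z.1 z.2) (univ ×ˢ Ici 0))
    {h m ρ : ℝ} (hm : h ≤ m) (hρ : 0 < ρ) {θ : ℝ → ℝ}
    (hθ : IsMinFlow (avgSpeed ρ fun s => c h (parD u₀ h s)) θ) {a b : ℝ} (ha : 0 ≤ a)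
    (hab : a ≤ b) (hstep : 2 * M * (b - a) ≤ ρ)
    (hPa : ∀ x ∈ parD u₀ h (θ a + 2 * ρ), v x a ≤ m) :
    ∀ x ∈ parD u₀ h (θ b + 2 * ρ), v x b ≤ m := by
  have hg := hc.isMonoSpeed u₀ h
  have hM := hg.bound_nonneg
  have hĝ := hg.avg hρ
  have hĝc := hg.continuous_avgSpeed hρ
  set g : ℝ → ℝ := fun s => c h (parD u₀ h s) with hgdef
  have hθ' : ∀ t, 0 < t → HasDerivAt θ (avgSpeed ρ g (θ t)) t := fun t ht =>
    hθ.hasDerivAt hĝ hĝc ht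
  have hθC : ContDiffOn ℝ 1 θ (Ioi 0) := by
    rw [show (1 : WithTop ℕ∞) = 0 + 1 from rfl, contDiffOn_succ_iff_deriv_of_isOpen isOpen_Ioi]
    refine ⟨fun t ht => (hθ' t ht).differentiableAt.differentiableWithinAt, by simp, ?_⟩
    rw [contDiffOn_zero]
    refine ((hĝc.comp_continuousOn hθ.cont).mono Ioi_subset_Ici_self).congr fun t ht => ?_
    exact (hθ' t ht).deriv
  -- On the whole time step, the inclusion holds with half the margin.
  have hhalf : ∀ s, a ≤ s → s ≤ b → ∀ y ∈ parD u₀ h (θ s + ρ), v y s ≤ m := by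
    intro s has hsb y hy
    refine hsub.le_of_finite_speed hc hv ha has fun z hz => hPa z ?_
    refine parD_mono u₀ le_rfl ?_ (sd_lt_add_of_dist_le hy hz)
    have h1 := (abs_le.1 (hθ.abs_sub_le hĝ ha (ha.trans has))).2
    rw [abs_of_nonneg (by linarith)] at h1
    have h2 : M * (s - a) ≤ M * (b - a) := by gcongr
    linarith
  have hspeed : ∀ (φ : EuclideanSpace ℝ (Fin n) → ℝ → ℝ) (x₀ : EuclideanSpace ℝ (Fin n)) (t₀ : ℝ),
      ContDiffOn ℝ 1 (fun z : EuclideanSpace ℝ (Fin n) × ℝ => φ z.1 z.2) (univ ×ˢ Ioi 0) →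
      a < t₀ → t₀ < b →
      IsLocalMax (fun z : EuclideanSpace ℝ (Fin n) × ℝ => v z.1 z.2 - φ z.1 z.2) (x₀, t₀) →
      m < v x₀ t₀ →
      deriv (fun t => φ x₀ t) t₀ + ‖gradient (fun x => φ x t₀) x₀‖ * avgSpeed ρ g (θ t₀) ≤ 0 := by
    intro φ x₀ t₀ hφ h1 h2 hmax hmv
    have h3 := hsub.le_of_mem_subset hc hm (hhalf t₀ h1.le h2.le) hφ (ha.trans_lt h1) hmax hmv
    have h4 := mul_le_mul_of_nonneg_left (hg.avgSpeed_le hρ (θ t₀))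
      (norm_nonneg (gradient (fun x => φ x t₀) x₀))
    simp only [hgdef] at h4 ⊢
    linarith
  have hb : 0 ≤ b := ha.trans hab
  intro x hx
  rcases hθ.dichotomy hĝ with ⟨hneg, hanti⟩ | ⟨hpos, hmono⟩
  · -- Shrinking front: the whole ball of dependence lies in the earlier set.
    refine le_of_propagation (E := fun _ => 0) (E' := fun _ => 0) (κ := fun t => -θ t)
      (κ' := fun t => -avgSpeed ρ g (θ t)) hv ha hab contDiffOn_const continuousOn_const
      (fun t _ => hasDerivAt_const t _) hθC.neg hθ.cont.neg
      (fun s hs t ht hst => neg_le_neg (hanti hs ht hst)) (fun t ht => (hθ' t ht).neg) ?_ ?_ ?_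
    · intro t ht
      exact nonneg_of_hasDerivAt_of_monotoneOn
        (fun s hs t ht hst => neg_le_neg (hanti hs ht hst)) ht (hθ' t ht).neg
    · intro φ x₀ t₀ hφ h1 h2 hmax hmv
      have := hspeed φ x₀ t₀ hφ h1 h2 hmax hmv
      rw [inner_zero_left]
      linarith
    · intro y hy
      refine hPa y (parD_mono u₀ le_rfl ?_ (sd_lt_add_of_dist_le (ρ := θ a - θ b) hx ?_))
      · linarith
      · rw [dist_comm, dist_eq_norm]
        simp only [sub_zero] at hy
        linarith
  · -- Growing front: follow the straight characteristic to a point of the earlier set.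
    have hθab : θ a ≤ θ b := hmono ha hb hab
    obtain ⟨y, hxy, hy⟩ := exists_sd_lt_of_sd_lt_add (s := θ a + 2 * ρ) (ρ := θ b - θ a)
      (by linarith [hpos a ha]) (by linarith) (sd_lt_mono hx (by linarith))
    obtain ⟨e, he, hex⟩ : ∃ e : EuclideanSpace ℝ (Fin n), ‖e‖ ≤ 1 ∧ (θ b - θ a) • e = x - y := by
      rcases hθab.eq_or_lt with heq | hlt
      · rw [← heq, sub_self] at hxy
        exact ⟨0, by simp, by rw [dist_le_zero.1 hxy]; simp⟩
      · have hd : 0 < θ b - θ a := by linarith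
        refine ⟨(θ b - θ a)⁻¹ • (x - y), ?_, smul_inv_smul₀ hd.ne' _⟩
        rw [norm_smul, norm_inv, Real.norm_of_nonneg hd.le, inv_mul_le_iff₀ hd, mul_one,
          ← dist_eq_norm]
        exact hxy
    refine le_of_propagation (E := fun t => θ t • e) (E' := fun t => avgSpeed ρ g (θ t) • e)
      (κ := fun _ => 0) (κ' := fun _ => 0) hv ha hab (hθC.smul contDiffOn_const)
      (hθ.cont.smul continuousOn_const) (fun t ht => (hθ' t ht).smul_const e) contDiffOn_const
      continuousOn_const (fun _ _ _ _ _ => le_rfl) (fun t _ => hasDerivAt_const t _)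
      (fun _ _ => le_rfl) ?_ ?_
    · intro φ x₀ t₀ hφ h1 h2 hmax hmv
      have h3 := hspeed φ x₀ t₀ hφ h1 h2 hmax hmv
      have ht₀ : 0 < t₀ := ha.trans_lt h1
      have hsl := nonneg_of_hasDerivAt_of_monotoneOn hmono ht₀ (hθ' t₀ ht₀)
      set p := gradient (fun x => φ x t₀) x₀
      have h4 : inner ℝ e p ≤ ‖p‖ := by
        have := real_inner_le_norm e p
        have h5 : ‖e‖ * ‖p‖ ≤ 1 * ‖p‖ := by gcongr
        linarith
      have h5 := mul_le_mul_of_nonneg_left h4 hsl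
      rw [real_inner_smul_left]
      linarith
    · intro z hz
      have h1 : z = y := by
        have h2 : z - (x - θ b • e) - θ a • e = z - x + (θ b - θ a) • e := by
          rw [sub_smul]
          abel
        rw [sub_self, norm_le_zero_iff, h2, hex] at hz
        rw [← sub_eq_zero, ← hz]
        abel
      rw [h1]
      exact hPa y hy

/-- Every continuous subsolution lies below the representation. -/
theorem IsTestSub.le_levelSup (hsub : IsTestSub c v) (hc : IsSpeedLaw M c)
    (hu : UniformContinuous u₀) (hδ : IsFlowFamily c u₀ δ)
    (hv : ContinuousOn (fun z : EuclideanSpace ℝ (Fin n) × ℝ => v z.1 z.2) (univ ×ˢ Ici 0))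
    (hv0 : ∀ x, v x 0 ≤ u₀ x) (x : EuclideanSpace ℝ (Fin n)) {t : ℝ} (ht : 0 ≤ t) :
    v x t ≤ levelSup δ u₀ x t := by
  by_contra hcon
  push Not at hcon
  obtain ⟨m, hLm, hmv⟩ := exists_between hcon
  obtain ⟨h, hLh, hhm⟩ := exists_between hLm
  obtain ⟨r, hr, hgap⟩ := exists_parD_gap hu hhm
  have hg := hc.isMonoSpeed u₀ h
  have hM := hg.bound_nonneg
  have hρ : 0 < r / 2 := half_pos hr
  obtain ⟨θ, hθ⟩ := (hg.avg hρ).exists_isMinFlow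
  have hδθ : δ h t ≤ θ t := by
    refine (hδ h).le_of_super θ hθ.cont (fun t ht => ?_) t ht
    rw [hθ.eq_integral t ht]
    exact intervalIntegral.integral_mono_on ht (hg.intervalIntegrable hθ.cont le_rfl ht)
      ((hg.avg hρ).intervalIntegrable hθ.cont le_rfl ht) fun s _ => hg.le_avgSpeed hρ _
  set τ := r / 2 / (2 * M + 1)
  have hτ : 0 < τ := by positivity
  have hMτ : 2 * M * τ ≤ r / 2 := by
    have h1 : (2 * M + 1) * τ = r / 2 := by simp only [τ]; field_simp
    linarith
  have hfront : ∀ k : ℕ, ∀ t, 0 ≤ t → t ≤ k * τ →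
      ∀ x ∈ parD u₀ h (θ t + 2 * (r / 2)), v x t ≤ m := by
    intro k
    induction k with
    | zero =>
      intro t ht htk x hx
      have ht0 : t = 0 := le_antisymm (by simpa using htk) ht
      rw [ht0, hθ.zero] at hx
      rw [ht0]
      have h1 := hgap h m _ le_rfl hx
      rw [show 0 + 2 * (r / 2) - r = 0 by ring, mem_parD_zero hu.continuous] at h1
      exact (hv0 x).trans h1.le
    | succ k ih =>
      intro t ht htk
      push_cast at htk
      have h1 : max (t - τ) 0 ≤ t := max_le (by linarith) ht
      have h2 : t - max (t - τ) 0 ≤ τ := by linarith [le_max_left (t - τ) 0]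
      refine hsub.front_step hc hv hhm.le hρ hθ (le_max_right _ _) h1 ?_
        (ih _ (le_max_right _ _) (max_le (by linarith) (by positivity)))
      have h3 : 2 * M * (t - max (t - τ) 0) ≤ 2 * M * τ := by gcongr
      linarith
  obtain ⟨k, hk⟩ := exists_nat_ge (t / τ)
  rw [div_le_iff₀ hτ] at hk
  have h1 := hfront k t ht hk x (parD_mono u₀ le_rfl (by linarith)
    (hδ.mem_parD_of_lt hc hu.continuous ht hLh))
  linarith

end NonlocalHJ

namespace NonlocalHJ

/-! ### Thresholds and duality -/

variable {n : ℕ} {M : ℝ} {c : ℝ → Set (EuclideanSpace ℝ (Fin n)) → ℝ}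
  {u₀ : EuclideanSpace ℝ (Fin n) → ℝ} {δ δ' : ℝ → ℝ → ℝ} {v : EuclideanSpace ℝ (Fin n) → ℝ → ℝ}
  {x : EuclideanSpace ℝ (Fin n)} {t h hbar : ℝ}

theorem IsFlowFamily.nonneg_of_threshold_lt (hδ : IsFlowFamily c u₀ δ) (hc : IsSpeedLaw M c)
    (hu : UniformContinuous u₀) (hthr : 0 ≤ c hbar {x | u₀ x ≤ hbar}) (hh : hbar < h)
    (ht : 0 ≤ t) : 0 ≤ δ h t := by
  obtain ⟨a, ha1, ha2⟩ := exists_between hh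
  obtain ⟨r, hr, hgap⟩ := exists_parD_gap hu ha2
  refine (hδ h).nonneg (hc.isMonoSpeed u₀ h) hr (hthr.trans (hc.mono hh.le fun x hx => ?_)) ht
  have hx' : u₀ x ≤ hbar := hx
  have := hgap a h 0 le_rfl ((mem_parD_zero hu.continuous).2 (hx'.trans_lt ha1))
  rwa [zero_sub] at this

theorem IsFlowFamily.nonpos_of_le_threshold (hδ : IsFlowFamily c u₀ δ) (hc : IsSpeedLaw M c)
    (hu : Continuous u₀) (hthr : c hbar {x | u₀ x < hbar} ≤ 0) (hh : h ≤ hbar) (ht : 0 ≤ t) :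
    δ h t ≤ 0 :=
  (hδ h).nonpos ((hc.mono hh fun _ hx => ((mem_parD_zero hu).1 hx).trans_le hh).trans hthr) ht

/-- The speed law seen by `-v` when `v` obeys `c`: it exchanges subsolutions with supersolutions
and open sublevel sets with complements of closed ones. -/
def dualLaw (c : ℝ → Set (EuclideanSpace ℝ (Fin n)) → ℝ) (h : ℝ)
    (S : Set (EuclideanSpace ℝ (Fin n))) : ℝ :=
  -c (-h) Sᶜ

theorem dualLaw_parD (c : ℝ → Set (EuclideanSpace ℝ (Fin n)) → ℝ)
    (u₀ : EuclideanSpace ℝ (Fin n) → ℝ) (h s : ℝ) :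
    dualLaw c (-h) (parD (fun x => -u₀ x) (-h) s) = -c h (parE u₀ h (-s)) := by
  rw [dualLaw, neg_neg, ← neg_neg s, ← compl_parE, compl_compl, neg_neg]

theorem parD_subset_parE (u₀ : EuclideanSpace ℝ (Fin n) → ℝ) (h s : ℝ) :
    parD u₀ h s ⊆ parE u₀ h s := fun _ hx =>
  le_of_lt (sd_lt_mono_set (fun _ (hy : u₀ _ < h) => hy.le) hx)

theorem parE_subset_parD {h' s s' : ℝ} (hh : h < h') (hs : s < s') :
    parE u₀ h s ⊆ parD u₀ h' s' := fun _ hx =>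
  sd_lt_mono_set (fun _ (hy : u₀ _ ≤ h) => hy.trans_lt hh)
    (lt_of_le_of_lt hx (EReal.coe_lt_coe_iff.2 hs))

/-- The flow of the closed parallel sets solves the integrated inclusion with the speed
`c h (parE u₀ h ·)`. -/
theorem IsFlowFamily.neg_eq_integral (hδ' : IsFlowFamily (dualLaw c) (fun x => -u₀ x) δ') (h : ℝ)
    (ht : 0 ≤ t) : -δ' (-h) t = ∫ s in (0 : ℝ)..t, c h (parE u₀ h (-δ' (-h) s)) := by
  rw [(hδ' (-h)).eq_integral t ht, ← intervalIntegral.integral_neg]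
  simp only [dualLaw_parD, neg_neg]

theorem IsFlowFamily.intervalIntegrable_parE
    (hδ' : IsFlowFamily (dualLaw c) (fun x => -u₀ x) δ') (hc' : IsSpeedLaw M (dualLaw c)) (h : ℝ)
    (ht : 0 ≤ t) : IntervalIntegrable (fun s => c h (parE u₀ h (-δ' (-h) s))) volume 0 t := by
  have := ((hc'.isMonoSpeed (fun x => -u₀ x) (-h)).intervalIntegrable (hδ' (-h)).cont le_rfl ht).neg
  refine this.congr fun s _ => ?_
  simp only [Pi.neg_apply, dualLaw_parD, neg_neg]

/-- The representations by open and by closed parallel sets coincide. -/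
theorem levelSup_eq_neg_levelSup_dual (hδ : IsFlowFamily c u₀ δ) (hc : IsSpeedLaw M c)
    (hδ' : IsFlowFamily (dualLaw c) (fun x => -u₀ x) δ') (hc' : IsSpeedLaw M (dualLaw c))
    (hu : UniformContinuous u₀) (x : EuclideanSpace ℝ (Fin n)) (ht : 0 ≤ t) :
    levelSup δ u₀ x t = -levelSup δ' (fun x => -u₀ x) x t := by
  have hu' : Continuous fun x => -u₀ x := hu.continuous.neg
  -- `x ∈ parE u₀ h (-δ' (-h) t)` is membership in the closed set at level `h`.
  have hE : ∀ h, x ∉ parD (fun x => -u₀ x) (-h) (δ' (-h) t) ↔ x ∈ parE u₀ h (-δ' (-h) t) := by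
    intro h
    have := compl_parE u₀ h (-δ' (-h) t)
    rw [neg_neg] at this
    rw [← this, notMem_compl_iff]
  refine le_antisymm ?_ ?_
  · by_contra hcon
    push Not at hcon
    obtain ⟨h₂, h1, h2⟩ := exists_between hcon
    obtain ⟨h₁, h3, h4⟩ := exists_between h1
    have hx1 : x ∈ parE u₀ h₁ (-δ' (-h₁) t) := by
      rw [← hE]
      exact hδ'.notMem_parD_of_lt hc' hu' ht (by linarith)
    have hx2 := hδ.notMem_parD_of_lt hc hu.continuous ht h2
    obtain ⟨a, ha1, ha2⟩ := exists_between h4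
    obtain ⟨r, hr, hgap⟩ := exists_parD_gap hu ha2
    have hsub : ∀ s, parE u₀ h₁ s ⊆ parD u₀ h₂ (s - r / 2) := fun s y hy => by
      have := hgap a h₂ (s + r / 2) le_rfl (parE_subset_parD ha1 (by linarith) hy)
      rwa [show s + r / 2 - r = s - r / 2 by ring] at this
    have hle : -δ' (-h₁) t ≤ δ h₂ t := by
      refine le_of_integrands_le_of_gap (δ₁ := fun t => -δ' (-h₁) t) (half_pos hr)
        (fun t ht => hδ'.intervalIntegrable_parE hc' h₁ ht)
        (fun t ht => (hc.isMonoSpeed u₀ h₂).intervalIntegrable (hδ h₂).cont le_rfl ht)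
        (hδ' (-h₁)).cont.neg (hδ h₂).cont (fun t ht => hδ'.neg_eq_integral h₁ ht)
        (fun t ht => (hδ h₂).eq_integral t ht) (fun s _ hs => ?_) ht
      exact hc.mono h4.le ((hsub _).trans (parD_mono u₀ le_rfl hs.le))
    exact hx2 (parD_mono u₀ le_rfl (by linarith) (hsub _ hx1))
  · refine le_of_forall_gt_imp_ge_of_dense fun h hh => ?_
    have hx := hδ.mem_parD_of_lt hc hu.continuous ht hh
    have hle : δ h t ≤ -δ' (-h) t := by
      refine (hδ h).le_of_super (fun t => -δ' (-h) t) (hδ' (-h)).cont.neg (fun t ht => ?_) t ht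
      rw [hδ'.neg_eq_integral h ht]
      exact intervalIntegral.integral_mono_on ht
        ((hc.isMonoSpeed u₀ h).intervalIntegrable (hδ' (-h)).cont.neg le_rfl ht)
        (hδ'.intervalIntegrable_parE hc' h ht)
        fun s _ => hc.mono le_rfl (parD_subset_parE u₀ h _)
    have := hδ'.le_levelSup hc' hu' ht
      ((hE h).2 (parD_subset_parE u₀ h _ (parD_mono u₀ le_rfl hle hx)))
    linarith

/-! ### The law `f(h, μ(S))` -/

variable {f : ℝ → ℝ≥0 → ℝ} {Θ : EuclideanSpace ℝ (Fin n) → ℝ}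

theorem AssumptionA3.isFiniteMeasure (hA3 : AssumptionA3 Θ) :
    IsFiniteMeasure (weightedMeasure Θ) :=
  isFiniteMeasure_withDensity_ofReal hA3.integrable.2

theorem AssumptionA3.mu_mono (hA3 : AssumptionA3 Θ) {S S' : Set (EuclideanSpace ℝ (Fin n))}
    (hS : S ⊆ S') : mu Θ S ≤ mu Θ S' := by
  have := hA3.isFiniteMeasure
  exact ENNReal.toNNReal_mono (measure_ne_top _ _) (measure_mono hS)

theorem AssumptionA2.mono (hA2 : AssumptionA2 f) {r₁ r₂ : ℝ} {q₁ q₂ : ℝ≥0} (hr : r₁ ≤ r₂)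
    (hq : q₁ ≤ q₂) : f r₁ q₁ ≤ f r₂ q₂ := by
  have h1 : f r₁ q₁ ≤ f r₂ q₁ := by
    rcases hr.eq_or_lt with rfl | hr
    · exact le_rfl
    · exact hA2.mono_left _ _ _ hr
  rcases hq.eq_or_lt with rfl | hq
  · exact h1
  · exact h1.trans (hA2.strictMono_right _ _ _ hq).le

theorem isSpeedLaw_mu (hA1 : AssumptionA1 f) (hA2 : AssumptionA2 f) (hA3 : AssumptionA3 Θ)
    (hM : ∀ r q, |f r q| ≤ M) : IsSpeedLaw M fun h S => f h (mu Θ S) where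
  mono hh hS := hA2.mono hh (hA3.mu_mono hS)
  bound _ _ := hM _ _
  tendsto a h S _ ha hS _ := by
    have := hA3.isFiniteMeasure
    have h1 : Tendsto (fun k => mu Θ (S k)) atTop (𝓝 (mu Θ (⋃ k, S k))) :=
      (ENNReal.tendsto_toNNReal (measure_ne_top _ _)).comp (tendsto_measure_iUnion_atTop hS)
    exact (hA1.cont.tendsto (h, mu Θ (⋃ k, S k))).comp (ha.prodMk_nhds h1)

theorem isSpeedLaw_dual_mu (hA1 : AssumptionA1 f) (hA2 : AssumptionA2 f) (hA3 : AssumptionA3 Θ)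
    (hM : ∀ r q, |f r q| ≤ M) : IsSpeedLaw M (dualLaw fun h S => f h (mu Θ S)) where
  mono hh hS := neg_le_neg (hA2.mono (neg_le_neg hh) (hA3.mu_mono (compl_subset_compl.2 hS)))
  bound _ _ := by
    rw [dualLaw, abs_neg]
    exact hM _ _
  tendsto a h S _ ha hS hSo := by
    have := hA3.isFiniteMeasure
    have h1 : Tendsto (fun k => mu Θ (S k)ᶜ) atTop (𝓝 (mu Θ (⋃ k, S k)ᶜ)) := by
      rw [compl_iUnion]
      exact (ENNReal.tendsto_toNNReal (measure_ne_top _ _)).comp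
        (tendsto_measure_iInter_atTop (fun k => (hSo k).measurableSet.compl.nullMeasurableSet)
          (fun i j hij => compl_subset_compl.2 (hS hij)) ⟨0, measure_ne_top _ _⟩)
    exact ((hA1.cont.tendsto (-h, mu Θ (⋃ k, S k)ᶜ)).comp (ha.neg.prodMk_nhds h1)).neg

/-! ### The distance inclusions -/

theorem IsMinFlow.lipschitzOnWith {g δ : ℝ → ℝ} (hδ : IsMinFlow g δ) (hg : IsMonoSpeed M g) :
    LipschitzOnWith (Real.toNNReal M) δ (Ici 0) :=
  LipschitzOnWith.of_dist_le_mul fun s hs t ht => by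
    rw [Real.dist_eq, Real.dist_eq, Real.coe_toNNReal _ hg.bound_nonneg]
    exact hδ.abs_sub_le hg ht hs

theorem IsDistSol.congr {W : ℝ → Set (EuclideanSpace ℝ (Fin n))} {δ η : ℝ → ℝ}
    (hδ : IsDistSol f Θ W h δ) (heq : ∀ t, 0 ≤ t → η t = δ t) : IsDistSol f Θ W h η where
  lipschitz := by
    obtain ⟨K, hK⟩ := hδ.lipschitz
    exact ⟨K, fun s hs t ht => by rw [heq s hs, heq t ht]; exact hK hs ht⟩
  init := by rw [heq 0 le_rfl, hδ.init]
  ineq := by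
    have h1 := hδ.ineq
    rw [ae_restrict_iff' measurableSet_Ici] at h1 ⊢
    have h2 : ∀ᵐ t : ℝ, t ≠ 0 := by simp [ae_iff, measure_singleton]
    filter_upwards [h1, h2] with t ht ht0 htI
    have hpos : 0 < t := lt_of_le_of_ne htI (Ne.symm ht0)
    obtain ⟨d, hd, hd1, hd2⟩ := ht htI
    rw [heq t htI]
    refine ⟨d, hd.congr_of_eventuallyEq ?_, hd1, hd2⟩
    filter_upwards [lt_mem_nhds hpos] with s hs using heq s hs.le


theorem isMinDistSol_flow
    (hc : IsSpeedLaw M fun h S => f h (mu Θ S)) (hδ : IsFlowFamily (fun h S => f h (mu Θ S)) u₀ δ)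
    (h : ℝ) : IsMinDistSol f Θ (parD u₀ h) h (δ h) := by
  have hg := hc.isMonoSpeed u₀ h
  refine ⟨⟨⟨_, (hδ h).lipschitzOnWith hg⟩, (hδ h).zero, ?_⟩, fun η hη t ht => ?_⟩
  · filter_upwards [(hδ h).ae_hasDerivAt hg] with t ht
    exact ⟨_, ht, hc.mono le_rfl interior_subset, hc.mono le_rfl subset_closure⟩
  · obtain ⟨K, hK⟩ := hη.lipschitz
    refine (hδ h).le_of_super η hK.continuousOn (fun t ht => ?_) t ht
    refine integral_le_of_ae_hasDerivAt hK hη.init ht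
      (hg.intervalIntegrable hK.continuousOn le_rfl ht) ?_
    filter_upwards [hη.ineq] with s hs
    obtain ⟨d, hd, hd1, -⟩ := hs
    rw [(isOpen_parD u₀ h _).interior_eq] at hd1
    exact ⟨d, hd, hd1⟩

theorem isMaxDistSol_flow (hc : IsSpeedLaw M fun h S => f h (mu Θ S))
    (hc' : IsSpeedLaw M (dualLaw fun h S => f h (mu Θ S)))
    (hδ' : IsFlowFamily (dualLaw fun h S => f h (mu Θ S)) (fun x => -u₀ x) δ') (h : ℝ) :
    IsMaxDistSol f Θ (parE u₀ h) h (fun t => -δ' (-h) t) := by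
  have hg := hc'.isMonoSpeed (fun x => -u₀ x) (-h)
  have hL : ∀ {η : ℝ → ℝ} {K : ℝ≥0}, LipschitzOnWith K η (Ici 0) →
      LipschitzOnWith K (fun t => -η t) (Ici 0) := fun {η K} hK s hs t ht => by
    rw [edist_neg_neg]
    exact hK hs ht
  refine ⟨⟨⟨_, hL ((hδ' (-h)).lipschitzOnWith hg)⟩, by simp [(hδ' (-h)).zero], ?_⟩,
    fun η hη t ht => ?_⟩
  · filter_upwards [(hδ' (-h)).ae_hasDerivAt hg] with t ht
    have h1 := ht.neg
    rw [dualLaw_parD, neg_neg] at h1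
    exact ⟨_, h1, hc.mono le_rfl interior_subset, hc.mono le_rfl subset_closure⟩
  · obtain ⟨K, hK⟩ := hη.lipschitz
    rw [le_neg]
    refine (hδ' (-h)).le_of_super (fun t => -η t) (hL hK).continuousOn (fun t ht => ?_) t ht
    refine integral_le_of_ae_hasDerivAt (hL hK) (by simp [hη.init]) ht
      (hg.intervalIntegrable (hL hK).continuousOn le_rfl ht) ?_
    filter_upwards [hη.ineq] with s hs
    obtain ⟨d, hd, -, hd2⟩ := hs
    have hcl : IsClosed (parE u₀ h (η s)) := by
      rw [← isOpen_compl_iff, compl_parE]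
      exact isOpen_parD _ _ _
    rw [hcl.closure_eq] at hd2
    refine ⟨-d, hd.neg, ?_⟩
    rw [dualLaw_parD, neg_neg]
    exact neg_le_neg hd2


theorem deltaD_eq {η : ℝ → ℝ} (hη : IsMinDistSol f Θ (parD u₀ h) h η) (ht : 0 ≤ t) :
    deltaD f Θ u₀ t h = η t :=
  IsLeast.csInf_eq ⟨⟨η, hη.1, rfl⟩, by
    rintro _ ⟨ζ, hζ, rfl⟩
    exact hη.2 ζ hζ t ht⟩

theorem deltaE_eq {η : ℝ → ℝ} (hη : IsMaxDistSol f Θ (parE u₀ h) h η) (ht : 0 ≤ t) :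
    deltaE f Θ u₀ t h = η t :=
  IsGreatest.csSup_eq ⟨⟨η, hη.1, rfl⟩, by
    rintro _ ⟨ζ, hζ, rfl⟩
    exact hη.2 ζ hζ t ht⟩

theorem isMinDistSol_deltaD {η : ℝ → ℝ} (hη : IsMinDistSol f Θ (parD u₀ h) h η) :
    IsMinDistSol f Θ (parD u₀ h) h (fun t => deltaD f Θ u₀ t h) :=
  ⟨hη.1.congr fun _ ht => deltaD_eq hη ht, fun ζ hζ t ht => by
    simp only [deltaD_eq hη ht]
    exact hη.2 ζ hζ t ht⟩

theorem isMaxDistSol_deltaE {η : ℝ → ℝ} (hη : IsMaxDistSol f Θ (parE u₀ h) h η) :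
    IsMaxDistSol f Θ (parE u₀ h) h (fun t => deltaE f Θ u₀ t h) :=
  ⟨hη.1.congr fun _ ht => deltaE_eq hη ht, fun ζ hζ t ht => by
    simp only [deltaE_eq hη ht]
    exact hη.2 ζ hζ t ht⟩

/-! ### The value functions over balls -/

theorem isCompact_ballValues (hu : Continuous u₀) (x : EuclideanSpace ℝ (Fin n)) (h ρ : ℝ) :
    IsCompact (ballValues u₀ x h ρ) := by
  have : ballValues u₀ x h ρ = (fun y => U0 u₀ y h) '' Metric.closedBall x ρ := by
    ext r
    simp only [ballValues, mem_ofPred_eq, mem_image, mem_closedBall_iff_norm, eq_comm]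
  rw [this]
  exact (isCompact_closedBall x ρ).image (hu.sub continuous_const)

theorem nonempty_ballValues (u₀ : EuclideanSpace ℝ (Fin n) → ℝ) (x : EuclideanSpace ℝ (Fin n))
    (h : ℝ) {ρ : ℝ} (hρ : 0 ≤ ρ) : (ballValues u₀ x h ρ).Nonempty :=
  ⟨U0 u₀ x h, x, by simpa using hρ, rfl⟩

theorem sInf_ballValues_nonneg_iff (hu : Continuous u₀) {ρ : ℝ} (hρ : 0 ≤ ρ) :
    0 ≤ sInf (ballValues u₀ x h ρ) ↔ ∀ y, dist y x ≤ ρ → h ≤ u₀ y := by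
  have hl := (isCompact_ballValues hu x h ρ).isLeast_sInf (nonempty_ballValues u₀ x h hρ)
  constructor
  · intro h0 y hy
    have := hl.2 ⟨y, by rwa [← dist_eq_norm], rfl⟩
    simp only [U0] at this
    linarith
  · intro H
    obtain ⟨y, hy, hyr⟩ := hl.1
    have := H y (by rwa [dist_eq_norm])
    rw [hyr, U0]
    linarith

theorem sInf_ballValues_nonpos_iff (hu : Continuous u₀) {ρ : ℝ} (hρ : 0 ≤ ρ) :
    sInf (ballValues u₀ x h ρ) ≤ 0 ↔ ∃ y, dist y x ≤ ρ ∧ u₀ y ≤ h := by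
  have hl := (isCompact_ballValues hu x h ρ).isLeast_sInf (nonempty_ballValues u₀ x h hρ)
  constructor
  · intro h0
    obtain ⟨y, hy, hyr⟩ := hl.1
    rw [hyr, U0] at h0
    exact ⟨y, by rwa [dist_eq_norm], by linarith⟩
  · rintro ⟨y, hy, hyh⟩
    have := hl.2 ⟨y, by rwa [← dist_eq_norm], rfl⟩
    simp only [U0] at this
    linarith

theorem sSup_ballValues_eq (u₀ : EuclideanSpace ℝ (Fin n) → ℝ) (x : EuclideanSpace ℝ (Fin n))
    (h ρ : ℝ) :
    sSup (ballValues u₀ x h ρ) = -sInf (ballValues (fun y => -u₀ y) x (-h) ρ) := by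
  have : ballValues (fun y => -u₀ y) x (-h) ρ = -ballValues u₀ x h ρ := by
    ext r
    simp only [ballValues, U0, Set.mem_neg, mem_ofPred_eq]
    refine exists_congr fun y => and_congr_right fun _ => ?_
    constructor <;> intro hr <;> linarith
  rw [this, Real.sInf_neg, neg_neg]

theorem UD_nonneg_iff (hu : Continuous u₀)
    (hpos : hbar < h → 0 ≤ deltaD f Θ u₀ t h) (hneg : h ≤ hbar → deltaD f Θ u₀ t h ≤ 0) :
    0 ≤ UD f Θ u₀ hbar x t h ↔ x ∉ parD u₀ h (deltaD f Θ u₀ t h) := by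
  have hA : IsOpen {y | u₀ y < h} := isOpen_lt hu continuous_const
  rw [UD]
  split_ifs with hh
  · rw [sInf_ballValues_nonneg_iff hu (hpos hh)]
    simp only [parD, mem_ofPred_eq]
    rw [sd_lt_iff_of_isOpen hA (hpos hh)]
    simp only [mem_ofPred_eq]
    push Not
    rfl
  · have h0 : 0 ≤ -deltaD f Θ u₀ t h := by linarith [hneg (not_lt.1 hh)]
    have h1 := sd_lt_neg_iff_of_isOpen (x := x) hA h0
    rw [neg_neg] at h1
    simp only [parD, mem_ofPred_eq]
    rw [sSup_ballValues_eq, neg_nonneg,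
      sInf_ballValues_nonpos_iff (u₀ := fun y => -u₀ y) hu.neg h0, h1]
    simp only [mem_ofPred_eq, neg_le_neg_iff]
    push Not
    rfl

theorem UE_nonpos_iff (hu : Continuous u₀)
    (hpos : hbar ≤ h → 0 ≤ deltaE f Θ u₀ t h) (hneg : h < hbar → deltaE f Θ u₀ t h ≤ 0) :
    UE f Θ u₀ hbar x t h ≤ 0 ↔ x ∉ parD (fun x => -u₀ x) (-h) (-deltaE f Θ u₀ t h) := by
  have hA : IsOpen {y | -u₀ y < -h} := isOpen_lt hu.neg continuous_const
  rw [UE]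
  split_ifs with hh
  · rw [sInf_ballValues_nonpos_iff hu (hpos hh)]
    simp only [parD, mem_ofPred_eq]
    rw [sd_lt_neg_iff_of_isOpen hA (hpos hh)]
    simp only [mem_ofPred_eq, neg_lt_neg_iff]
    push Not
    rfl
  · have h0 : 0 ≤ -deltaE f Θ u₀ t h := by linarith [hneg (not_le.1 hh)]
    simp only [parD, mem_ofPred_eq]
    rw [sSup_ballValues_eq, neg_nonpos, sInf_ballValues_nonneg_iff (u₀ := fun y => -u₀ y) hu.neg h0,
      sd_lt_iff_of_isOpen hA h0]
    simp only [mem_ofPred_eq, neg_le_neg_iff, neg_lt_neg_iff]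
    push Not
    rfl

/-! ### Viscosity solutions and growth -/

theorem IsTestSub.congr {w : EuclideanSpace ℝ (Fin n) → ℝ → ℝ} (hv : IsTestSub c v)
    (heq : ∀ x t, 0 ≤ t → w x t = v x t) : IsTestSub c w := by
  intro φ x₀ t₀ hφ ht₀ hmax
  have h1 := hv φ x₀ t₀ hφ ht₀ (hmax.congr (by
    filter_upwards [prod_mem_nhds univ_mem (Ioi_mem_nhds ht₀)] with z hz
    rw [heq z.1 z.2 (le_of_lt hz.2)]) : _)
  simp only [heq _ t₀ ht₀.le]
  exact h1

theorem gradient_neg (φ : EuclideanSpace ℝ (Fin n) → ℝ) (x : EuclideanSpace ℝ (Fin n)) :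
    gradient (fun x => -φ x) x = -gradient φ x := by
  simp [gradient, fderiv_fun_neg]

/-- `v` passes the supersolution test exactly when `-v` passes the subsolution test for the dual
law. -/
theorem isTestSub_dual_iff (f : ℝ → ℝ≥0 → ℝ) (Θ : EuclideanSpace ℝ (Fin n) → ℝ)
    (v : EuclideanSpace ℝ (Fin n) → ℝ → ℝ) :
    IsTestSub (dualLaw fun h S => f h (mu Θ S)) (fun x t => -v x t) ↔
    ∀ (φ : EuclideanSpace ℝ (Fin n) → ℝ → ℝ) (x₀ : EuclideanSpace ℝ (Fin n)) (t₀ : ℝ),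
      ContDiffOn ℝ 1 (fun z : EuclideanSpace ℝ (Fin n) × ℝ => φ z.1 z.2) (univ ×ˢ Ioi 0) →
      0 < t₀ →
      IsLocalMin (fun z : EuclideanSpace ℝ (Fin n) × ℝ => v z.1 z.2 - φ z.1 z.2) (x₀, t₀) →
      0 ≤ deriv (fun t => φ x₀ t) t₀ + ‖gradient (fun x => φ x t₀) x₀‖ *
        f (v x₀ t₀) (mu Θ {y | v y t₀ ≤ v x₀ t₀}) := by
  have hset : ∀ x₀ t₀, {y | -v y t₀ < -v x₀ t₀}ᶜ = {y | v y t₀ ≤ v x₀ t₀} := by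
    intro x₀ t₀
    ext y
    simp
  constructor
  · intro H φ x₀ t₀ hφ ht₀ hmin
    have h1 := H (fun x t => -φ x t) x₀ t₀ hφ.neg ht₀ (hmin.neg.congr (Eventually.of_forall
      fun z => by simp only; ring))
    rw [deriv.fun_neg, gradient_neg, norm_neg, dualLaw, hset, neg_neg] at h1
    linarith
  · intro H φ x₀ t₀ hφ ht₀ hmax
    have h1 := H (fun x t => -φ x t) x₀ t₀ hφ.neg ht₀ (hmax.neg.congr (Eventually.of_forall
      fun z => by simp only; ring))
    rw [deriv.fun_neg, gradient_neg, norm_neg] at h1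
    rw [dualLaw, hset, neg_neg]
    linarith

theorem exists_linear_bound (hu : UniformContinuous u₀) :
    ∃ C > 0, ∀ x, |u₀ x| ≤ C * (‖x‖ + 1) := by
  obtain ⟨r, hr, H⟩ := Metric.uniformContinuous_iff.1 hu 1 one_pos
  have hr2 : 0 < r / 2 := half_pos hr
  have hk : ∀ k : ℕ, ∀ x, ‖x‖ ≤ k * (r / 2) → |u₀ x - u₀ 0| ≤ k := by
    intro k
    induction k with
    | zero =>
      intro x hx
      have : x = 0 := by simpa using hx
      simp [this]
    | succ k ih =>
      intro x hx
      push_cast at hx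
      obtain ⟨y, hy1, hy2⟩ := exists_dist_le_le (x := x) (z := 0) hr2.le
        (by positivity : 0 ≤ (k : ℝ) * (r / 2)) (by rw [dist_zero_right]; linarith)
      rw [dist_zero_right] at hy2
      have h1 := H (show dist x y < r by linarith)
      rw [Real.dist_eq] at h1
      have h2 := abs_sub_le (u₀ x) (u₀ y) (u₀ 0)
      have h3 := ih y hy2
      push_cast
      linarith
  refine ⟨|u₀ 0| + 1 + 1 / (r / 2), by positivity, fun x => ?_⟩
  have h1 := hk ⌈‖x‖ / (r / 2)⌉₊ x ((div_le_iff₀ hr2).1 (Nat.le_ceil _))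
  have h2 := (Nat.ceil_lt_add_one (by positivity : 0 ≤ ‖x‖ / (r / 2))).le
  have h3 := abs_sub_abs_le_abs_sub (u₀ x) (u₀ 0)
  have h4 : ‖x‖ / (r / 2) = 1 / (r / 2) * ‖x‖ := by ring
  have h5 : 0 < 1 / (r / 2) := by positivity
  nlinarith [norm_nonneg x, abs_nonneg (u₀ 0), mul_nonneg (abs_nonneg (u₀ 0)) (norm_nonneg x)]

theorem IsFlowFamily.hasLinearGrowth (hδ : IsFlowFamily c u₀ δ) (hc : IsSpeedLaw M c)
    (hu : UniformContinuous u₀) : HasLinearGrowth (levelSup δ u₀) := by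
  obtain ⟨C, hC, hCu⟩ := exists_linear_bound hu
  have hM := (hc.isMonoSpeed u₀ 0).bound_nonneg
  intro T hT
  refine ⟨C * (1 + M * T), by positivity, fun x t ht htT => ?_⟩
  refine hδ.abs_levelSup_le hc hu.continuous ht fun y hy => (hCu y).trans ?_
  rw [mul_assoc]
  refine mul_le_mul_of_nonneg_left ?_ hC.le
  have h1 : ‖y‖ ≤ ‖x‖ + ‖y - x‖ := norm_le_norm_add_norm_sub' y x
  rw [dist_eq_norm] at hy
  have h2 : M * t ≤ M * T := by gcongr
  have h3 : 0 ≤ M * T * ‖x‖ := by positivity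
  linarith

theorem isLocBounded_of_continuousOn
    (hv : ContinuousOn (fun z : EuclideanSpace ℝ (Fin n) × ℝ => v z.1 z.2) (univ ×ˢ Ici 0)) :
    IsLocBounded v := by
  intro x t ht
  have h1 : ContinuousAt (fun z : EuclideanSpace ℝ (Fin n) × ℝ => v z.1 z.2) (x, t) :=
    hv.continuousAt (prod_mem_nhds univ_mem (Ici_mem_nhds ht))
  exact ⟨|v x t| + 1, (h1.abs.eventually (gt_mem_nhds (lt_add_one |v x t|))).mono fun _ hz => hz.le⟩

end NonlocalHJ

theorem theorem1p1 (n : ℕ) (hn : 1 ≤ n) (f : ℝ → ℝ≥0 → ℝ)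
    (Θ u₀ : EuclideanSpace ℝ (Fin n) → ℝ)
    (hA1 : NonlocalHJ.AssumptionA1 f) (hA2 : NonlocalHJ.AssumptionA2 f)
    (hA3 : NonlocalHJ.AssumptionA3 Θ) (hA4 : NonlocalHJ.AssumptionA4 u₀)
    (hbar : ℝ) (hthr : NonlocalHJ.IsThreshold f Θ u₀ hbar) :
    -- the extremal solutions of the distance inclusion exist and are `δ_D`, `δ_E`
    (∀ h : ℝ, NonlocalHJ.IsMinDistSol f Θ (NonlocalHJ.parD u₀ h) h
        (fun t => NonlocalHJ.deltaD f Θ u₀ t h)) ∧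
    (∀ h : ℝ, NonlocalHJ.IsMaxDistSol f Θ (NonlocalHJ.parE u₀ h) h
        (fun t => NonlocalHJ.deltaE f Θ u₀ t h)) ∧
    -- the radii in the definitions of `U_D`, `U_E` are nonnegative
    (∀ t h : ℝ, 0 ≤ t →
      (hbar < h → 0 ≤ NonlocalHJ.deltaD f Θ u₀ t h) ∧
      (h ≤ hbar → NonlocalHJ.deltaD f Θ u₀ t h ≤ 0) ∧
      (hbar ≤ h → 0 ≤ NonlocalHJ.deltaE f Θ u₀ t h) ∧
      (h < hbar → NonlocalHJ.deltaE f Θ u₀ t h ≤ 0)) ∧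
    -- the supremum and the infimum defining `u_D`, `u_E` are finite
    (∀ (x : EuclideanSpace ℝ (Fin n)) (t : ℝ), 0 ≤ t →
      IsLUB {h : ℝ | 0 ≤ NonlocalHJ.UD f Θ u₀ hbar x t h} (NonlocalHJ.uD f Θ u₀ hbar x t) ∧
      IsGLB {h : ℝ | NonlocalHJ.UE f Θ u₀ hbar x t h ≤ 0} (NonlocalHJ.uE f Θ u₀ hbar x t)) ∧
    -- the two functions coincide
    (∀ (x : EuclideanSpace ℝ (Fin n)) (t : ℝ), 0 ≤ t →
      NonlocalHJ.uD f Θ u₀ hbar x t = NonlocalHJ.uE f Θ u₀ hbar x t) ∧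
    -- their common value is a solution of linear growth, and the only one
    NonlocalHJ.IsCauchySol f Θ u₀ (NonlocalHJ.uD f Θ u₀ hbar) ∧
    NonlocalHJ.HasLinearGrowth (NonlocalHJ.uD f Θ u₀ hbar) ∧
    (∀ v : EuclideanSpace ℝ (Fin n) → ℝ → ℝ,
      NonlocalHJ.IsCauchySol f Θ u₀ v → NonlocalHJ.HasLinearGrowth v →
      ∀ (x : EuclideanSpace ℝ (Fin n)) (t : ℝ), 0 ≤ t →
        v x t = NonlocalHJ.uD f Θ u₀ hbar x t) := by
  obtain ⟨M, hM⟩ := hA1.bounded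
  have hc := NonlocalHJ.isSpeedLaw_mu hA1 hA2 hA3 hM
  have hc' := NonlocalHJ.isSpeedLaw_dual_mu hA1 hA2 hA3 hM
  have hu := hA4.unifCont
  have hu' : UniformContinuous fun x => -u₀ x := hu.neg
  obtain ⟨δ, hδ⟩ := hc.exists_isFlowFamily u₀
  obtain ⟨δ', hδ'⟩ := hc'.exists_isFlowFamily fun x => -u₀ x
  have hmin := NonlocalHJ.isMinDistSol_flow hc hδ
  have hmax := NonlocalHJ.isMaxDistSol_flow hc hc' hδ'
  have hD : ∀ t h, 0 ≤ t → NonlocalHJ.deltaD f Θ u₀ t h = δ h t := fun t h ht =>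
    NonlocalHJ.deltaD_eq (hmin h) ht
  have hE : ∀ t h, 0 ≤ t → NonlocalHJ.deltaE f Θ u₀ t h = -δ' (-h) t := fun t h ht =>
    NonlocalHJ.deltaE_eq (hmax h) ht
  have hsgnD1 : ∀ t h, 0 ≤ t → hbar < h → 0 ≤ NonlocalHJ.deltaD f Θ u₀ t h := fun t h ht hh => by
    rw [hD t h ht]
    exact hδ.nonneg_of_threshold_lt hc hu hthr.2 hh ht
  have hsgnD2 : ∀ t h, 0 ≤ t → h ≤ hbar → NonlocalHJ.deltaD f Θ u₀ t h ≤ 0 := fun t h ht hh => by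
    rw [hD t h ht]
    exact hδ.nonpos_of_le_threshold hc hu.continuous hthr.1 hh ht
  -- Complementation turns the threshold conditions for `u₀` into those for `-u₀`.
  have hsgnE1 : ∀ t h, 0 ≤ t → hbar ≤ h → 0 ≤ NonlocalHJ.deltaE f Θ u₀ t h := fun t h ht hh => by
    rw [hE t h ht, neg_nonneg]
    refine hδ'.nonpos_of_le_threshold hc' hu'.continuous (hbar := -hbar) ?_ (neg_le_neg hh) ht
    have : {x | -u₀ x < -hbar}ᶜ = {x | u₀ x ≤ hbar} := by
      ext y
      simp
    rw [NonlocalHJ.dualLaw, this, neg_neg, neg_nonpos]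
    exact hthr.2
  have hsgnE2 : ∀ t h, 0 ≤ t → h < hbar → NonlocalHJ.deltaE f Θ u₀ t h ≤ 0 := fun t h ht hh => by
    rw [hE t h ht, neg_nonpos]
    refine hδ'.nonneg_of_threshold_lt hc' hu' (hbar := -hbar) ?_ (neg_lt_neg hh) ht
    have : {x | -u₀ x ≤ -hbar}ᶜ = {x | u₀ x < hbar} := by
      ext y
      simp
    rw [NonlocalHJ.dualLaw, this, neg_neg, neg_nonneg]
    exact hthr.1
  have hsetD : ∀ x t, 0 ≤ t →
      {h : ℝ | 0 ≤ NonlocalHJ.UD f Θ u₀ hbar x t h} = {h | x ∉ NonlocalHJ.parD u₀ h (δ h t)} := by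
    intro x t ht
    ext h
    simp only [mem_ofPred_eq]
    rw [NonlocalHJ.UD_nonneg_iff hu.continuous (hsgnD1 t h ht) (hsgnD2 t h ht), hD t h ht]
  have hsetE : ∀ x t, 0 ≤ t → {h : ℝ | NonlocalHJ.UE f Θ u₀ hbar x t h ≤ 0}
      = -{h | x ∉ NonlocalHJ.parD (fun x => -u₀ x) h (δ' h t)} := by
    intro x t ht
    ext h
    simp only [mem_ofPred_eq, Set.mem_neg]
    rw [NonlocalHJ.UE_nonpos_iff hu.continuous (hsgnE1 t h ht) (hsgnE2 t h ht), hE t h ht, neg_neg]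
  have huD : ∀ x t, 0 ≤ t → NonlocalHJ.uD f Θ u₀ hbar x t = NonlocalHJ.levelSup δ u₀ x t := by
    intro x t ht
    rw [NonlocalHJ.uD, hsetD x t ht, NonlocalHJ.levelSup]
  have huE : ∀ x t, 0 ≤ t → NonlocalHJ.uE f Θ u₀ hbar x t
      = -NonlocalHJ.levelSup δ' (fun x => -u₀ x) x t := by
    intro x t ht
    rw [NonlocalHJ.uE, hsetE x t ht, Real.sInf_neg, NonlocalHJ.levelSup]
  have hDE : ∀ x t, 0 ≤ t → NonlocalHJ.levelSup δ u₀ x t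
      = -NonlocalHJ.levelSup δ' (fun x => -u₀ x) x t := fun x t ht =>
    NonlocalHJ.levelSup_eq_neg_levelSup_dual hδ hc hδ' hc' hu x ht
  have hcont : ContinuousOn
      (fun z : EuclideanSpace ℝ (Fin n) × ℝ => NonlocalHJ.uD f Θ u₀ hbar z.1 z.2)
      (univ ×ˢ Ici 0) :=
    (hδ.continuousOn_levelSup hc hu).congr fun z hz => huD z.1 z.2 hz.2
  have hsubset : (univ ×ˢ Ioi 0 : Set (EuclideanSpace ℝ (Fin n) × ℝ)) ⊆ univ ×ˢ Ici 0 :=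
    prod_mono le_rfl Ioi_subset_Ici_self
  have hlb := NonlocalHJ.isLocBounded_of_continuousOn hcont
  refine ⟨fun h => NonlocalHJ.isMinDistSol_deltaD (hmin h),
    fun h => NonlocalHJ.isMaxDistSol_deltaE (hmax h),
    fun t h ht => ⟨hsgnD1 t h ht, hsgnD2 t h ht, hsgnE1 t h ht, hsgnE2 t h ht⟩,
    fun x t ht => ⟨?_, ?_⟩, fun x t ht => by rw [huD x t ht, huE x t ht, hDE x t ht],
    ⟨hcont, ⟨hlb, (hcont.mono hsubset).upperSemicontinuousOn, ?_⟩,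
      ⟨hlb, (hcont.mono hsubset).lowerSemicontinuousOn, ?_⟩, fun x => ?_⟩, ?_, ?_⟩
  · rw [huD x t ht, hsetD x t ht]
    exact hδ.isLUB_levelSup hc hu.continuous x ht
  · rw [huE x t ht, hsetE x t ht]
    exact (hδ'.isLUB_levelSup hc' hu'.continuous x ht).neg
  · exact (hδ.isTestSub_levelSup hc hu).congr huD
  · rw [← NonlocalHJ.isTestSub_dual_iff]
    refine (hδ'.isTestSub_levelSup hc' hu').congr fun x t ht => ?_
    rw [huD x t ht, hDE x t ht, neg_neg]
  · rw [huD x 0 le_rfl, hδ.levelSup_zero hu.continuous]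
  · intro T hT
    obtain ⟨C, hC, H⟩ := hδ.hasLinearGrowth hc hu T hT
    exact ⟨C, hC, fun x t ht htT => by rw [huD x t ht]; exact H x t ht htT⟩
  · intro v hv _ x t ht
    have hsub : NonlocalHJ.IsTestSub (fun h S => f h (NonlocalHJ.mu Θ S)) v := hv.sub.test
    have hsup := (NonlocalHJ.isTestSub_dual_iff f Θ v).2 hv.super.test
    rw [huD x t ht]
    refine le_antisymm (hsub.le_levelSup hc hu hδ hv.cont (fun x => (hv.init x).le) x ht) ?_
    have h1 := hsup.le_levelSup hc' hu' hδ' hv.cont.neg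
      (fun x => by rw [hv.init x]) x ht
    rw [hDE x t ht]
    linarith
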